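/- **Conventions.** All Hilbert spaces are finite dimensional and operators on a tensor factor are extended by the identity. Let $\sigma_X=\begin{pmatrix}0&1\\1&0\end{pmatrix}$, $\sigma_Z=\begin{pmatrix}1&0\\0&-1\end{pmatrix}$, $|\mathrm{EPR}\rangle=\frac1{\sqrt2}(|00\rangle+|11\rangle)$. A strategy in a two-player game consists of a unit vector $|\psi\rangle\in\mathcal H_A\otimes\mathcal H_B$ and, for each player and each question to that player, a POVM. For $a,b\in\{0,1\}^n$, $a+b$ is the bitwise XOR and $a\cdot b$ the inner product mod $2$. **Anticommutation games.** Let $w\in(0,1]$ and let $\delta:[0,1]\to[0,1]$ be continuous with $\delta(0)=0$. A two-player one-round game $G$ with finite question and answer sets is a $(w,\delta)$ anticommutation game, with special questions $q_X,q_Z$ to the second player and functions $f_X,f_Z$ from the second player's answers to $\{\pm1\}$, if: 1. *(Completeness)* the largest success probability of any strategy in $G$ is $w$, and it is achieved by a strategy with projective measurements on the state $|\mathrm{EPR}\rangle^{\otimes m}$ for some $m\ge1$, in which the second player's measurements $\{A_q^\alpha\}_\alpha$ satisfy $\sum_\alpha f_X(\alpha)A_{q_X}^\alpha=\sigma_X\otimes\mathrm{Id}$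 and $\sum_\alpha f_Z(\alpha)A_{q_Z}^\alpha=\sigma_Z\otimes\mathrm{Id}$, where $\sigma_X,\sigma_Z$ act on the first EPR pair. 2. *(Soundness)* for every $\varepsilon\in(0,1]$ and every strategy with projective measurements and success probability at least $w-\varepsilon$ in $G$, if $|\psi\rangle\in\mathcal H_A\otimes\mathcal H_B$ is its state (with $\mathcal H_A$ the second player's space) and $\{A_q^\alpha\}_\alpha$ are the second player's measurements, there are isometries $U:\mathcal H_A\to\mathbb C^2\otimes\mathcal H_{A'}$, $V:\mathcal H_B\to\mathbb C^2\otimes\mathcal H_{B'}$ and a unit vector $|\psi'\rangle\in\mathcal H_{A'}\otimes\mathcal H_{B'}$ such that, with $X=\sum_\alpha f_X(\alpha)A_{q_X}^\alpha$ and $Z=\sum_\alpha f_Z(\alpha)A_{q_Z}^\alpha$, the three numbers $\|U\otimes V|\psi\rangle-|\mathrm{EPR}\rangle\otimes|\psi'\rangle\|$, $\|(X-U^\dagger(\sigma_X\otimes\mathrm{Id})U)|\psi\rangle\|$ and $\|(Z-V^\dagger(\sigma_Z\otimes\mathrm{Id})V)|\psi\rangle\|$ are at most $\delta(\varepsilon)$.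 **Pauli braiding test.** Let $n\ge1$. Queries are of two types. A $W$-query consists of a basis $W\in\{X,Z\}$ and two strings in $\{0,1\}^n$, sent in lexicographic order; the answer is a sign in $\{\pm1\}$ for each string. A $G$-query $(q,a,b)$ consists of a question $q$ of $G$ (to its first or to its second player) and strings $a,b$; the answer is an answer of $G$. The verifier labels one of the two players, chosen uniformly at random, Alice and the other one Bob, and performs one of the following tests, with probability $\frac13$ each. * *Linearity.* Choose $W\in\{X,Z\}$ and $a,b,c'\in\{0,1\}^n$ uniformly at random, and let $c$ be $a$, $b$ or $a+b$ with probability $\frac13$ each. Send the $W$-query on $a,b$ to Alice and the $W$-query on $c,c'$ to Bob. Let $\alpha,\beta$ be Alice's answers for $a,b$ and $\gamma$ Bob's answer for $c$. Accept iff $\gamma=\alpha$, $\gamma=\beta$ or $\gamma=\alpha\beta$, respectively. * *Anticommutation.* Choose $(a,b)$ uniformly with $a\cdot b=1$, send $(a,b)$ to both players and play $G$ with them (Alice as first player, Bob as second player). * *Consistency.* Choose $(a,b)$ uniformly with $a\cdot b=1$ and $W\in\{X,Z\}$ uniformly, and send the $W$-query on $a,b$ to Alice. With probability $\frac12$ each: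 (i) sample $q$ from the second player's question distribution in $G$ and send $(q,a,b)$ to Bob, who answers $\alpha$; if $W=X$ and $q=q_X$ (resp. $W=Z$ and $q=q_Z$), accept iff Alice's answer for $a$ (resp. for $b$) equals $f_W(\alpha)$; otherwise accept; (ii) send Bob the $W$-query on $a,c$ with $c\in\{0,1\}^n$ uniformly random, and accept iff the product of the two players' answers for $a$ is $+1$. Put $\omega^*_{\mathrm{enc}}=\frac23+\frac13w$. **Corollary.** Let $G$ be a $(w,\delta)$ anticommutation game with $\delta(\varepsilon)=O(\sqrt\varepsilon)$. There is a constant $C>0$, depending only on $G$, its special questions and functions, $w$ and $\delta$ (and in particular not on $n$), such that for every $n\ge1$, every $\varepsilon>0$ and every strategy with shared state $|\psi\rangle_{AB}\in\mathcal H_A\otimes\mathcal H_B$ that has success probability at least $\omega^*_{\mathrm{enc}}-\varepsilon$ in the Pauli braiding test on $n$-bit strings, there are isometries $\Phi^A:\mathcal H_A\to\mathcal H_{A'}\otimes\mathcal H_{A''}$ and $\Phi^B:\mathcal H_B\to\mathcal H_{B'}\otimes\mathcal H_{B''}$ with $\mathcal H_{A'}=\mathcal H_{B'}=(\mathbb C^2)^{\otimes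 n}$ and $$\Big|\mathrm{Tr}\Big(\big(\langle\mathrm{EPR}|^{\otimes n}_{A'B'}\otimes\mathrm{Id}_{A''B''}\big)\,(\Phi^A\otimes\Phi^B)\big(|\psi\rangle\langle\psi|\big)\,\big(|\mathrm{EPR}\rangle^{\otimes n}_{A'B'}\otimes\mathrm{Id}_{A''B''}\big)\Big)-1\Big|\le C\,\varepsilon^{1/8}.$$ -/

import Mathlib

open scoped Kronecker Matrix BigOperators ComplexOrder

noncomputable section

namespace PauliBraiding

/-! Finite-dimensional Hilbert spaces are `ℂ^ι` for a finite index type `ι`; a vector of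
`ℂ^ι ⊗ ℂ^κ` is a function `ι × κ → ℂ`, operators are matrices, and the tensor product of
operators is the Kronecker product. -/

/-- The Euclidean norm of a vector. -/
def l2norm {ι : Type*} [Fintype ι] (v : ι → ℂ) : ℝ := ‖WithLp.toLp 2 v‖

/-- The density matrix `|v⟩⟨v|`. -/
def density {ι : Type*} (v : ι → ℂ) : Matrix ι ι ℂ := Matrix.vecMulVec v (star v)

/-- `U : ℂ^ι → ℂ^κ` is an isometry. -/
def IsIsometry {ι κ : Type*} [Fintype κ] [DecidableEq ι] (U : Matrix κ ι ℂ) : Prop :=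
  Uᴴ * U = 1

/-- The Pauli observable `σ_X`. -/
def pauliX : Matrix (Fin 2) (Fin 2) ℂ := !![0, 1; 1, 0]

/-- The Pauli observable `σ_Z`. -/
def pauliZ : Matrix (Fin 2) (Fin 2) ℂ := !![1, 0; 0, -1]

/-- The EPR pair `(|00⟩ + |11⟩) / √2`. -/
def epr (p : Fin 2 × Fin 2) : ℂ := if p.1 = p.2 then ((1 / √2 : ℝ) : ℂ) else 0

/-- `|EPR⟩^{⊗ n}`: the first player holds one half of each pair, the second the other. -/
def eprPow (n : ℕ) (p : (Fin n → Fin 2) × (Fin n → Fin 2)) : ℂ := ∏ i, epr (p.1 i, p.2 i)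

/-- The tensor product of a state of registers `I`, `J` and a state of registers `K`, `L`,
grouped as (first player `I`, `K`) and (second player `J`, `L`). -/
def tensorState {I J K L : Type*} (φ : I × J → ℂ) (χ : K × L → ℂ) :
    (I × K) × (J × L) → ℂ :=
  fun p => φ (p.1.1, p.2.1) * χ (p.1.2, p.2.2)

/-- A POVM with outcome set `α`. -/
structure IsPOVM {ι α : Type*} [Fintype ι] [DecidableEq ι] [Fintype α]
    (M : α → Matrix ι ι ℂ) : Prop where
  posSemidef : ∀ x, (M x).PosSemidef
  sum_eq_one : ∑ x, M x = 1

/-- A projective measurement with outcome set `α`. -/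
structure IsProjective {ι α : Type*} [Fintype ι] [DecidableEq ι] [Fintype α]
    (M : α → Matrix ι ι ℂ) : Prop extends IsPOVM M where
  proj : ∀ x, M x * M x = M x

/-- The probability `⟨ψ| M ⊗ N |ψ⟩` of a pair of outcomes with measurement operators `M`, `N`. -/
def born {ι κ : Type*} [Fintype ι] [Fintype κ] (ψ : ι × κ → ℂ)
    (M : Matrix ι ι ℂ) (N : Matrix κ κ ℂ) : ℝ :=
  (star ψ ⬝ᵥ ((M ⊗ₖ N) *ᵥ ψ)).re

open Classical in
/-- The probability that the outcomes `x`, `y` of local measurements `M`, `N` on `ψ` satisfy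
`acc x y`. -/
def acceptProb {ι κ α β : Type*} [Fintype ι] [Fintype κ] [Fintype α] [Fintype β]
    (ψ : ι × κ → ℂ) (M : α → Matrix ι ι ℂ) (N : β → Matrix κ κ ℂ) (acc : α → β → Prop) : ℝ :=
  ∑ x, ∑ y, if acc x y then born ψ (M x) (N y) else 0

/-- A two-player one-round game with question sets `Q₁`, `Q₂` and answer sets `A₁`, `A₂`. -/
structure TwoPlayerGame (Q₁ Q₂ A₁ A₂ : Type*) [Fintype Q₁] [Fintype Q₂] where
  /-- The joint distribution of the two questions. -/
  prob : Q₁ → Q₂ → ℝ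
  prob_nonneg : ∀ q r, 0 ≤ prob q r
  prob_sum : ∑ q, ∑ r, prob q r = 1
  /-- The verifier's decision. -/
  accept : Q₁ → Q₂ → A₁ → A₂ → Prop

section Games

variable {Q₁ Q₂ A₁ A₂ : Type} [Fintype Q₁] [Fintype Q₂] [Fintype A₁] [Fintype A₂]

/-- The success probability in `G` of the strategy with shared state `ψ` and measurements `M` of
the first player and `N` of the second player. -/
def TwoPlayerGame.success (G : TwoPlayerGame Q₁ Q₂ A₁ A₂) {ι κ : Type*} [Fintype ι] [Fintype κ]
    (ψ : ι × κ → ℂ) (M : Q₁ → A₁ → Matrix ι ι ℂ) (N : Q₂ → A₂ → Matrix κ κ ℂ) : ℝ :=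
  ∑ q, ∑ r, G.prob q r * acceptProb ψ (M q) (N r) (G.accept q r)

/-- The distribution of the second player's question. -/
def TwoPlayerGame.secondProb (G : TwoPlayerGame Q₁ Q₂ A₁ A₂) (r : Q₂) : ℝ := ∑ q, G.prob q r

/-- The observable `∑ₓ f(x) Nₓ` obtained by post-processing the outcome of `N` by a sign. -/
def signObs {κ α : Type*} [Fintype α] (f : α → ℤˣ) (N : α → Matrix κ κ ℂ) : Matrix κ κ ℂ :=
  ∑ x, ((f x : ℤ) : ℂ) • N x

/-- `G` is a `(w, δ)` anticommutation game with special questions `qX`, `qZ` to the second player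
and sign functions `fX`, `fZ` on the second player's answers. -/
structure IsAnticommutationGame (G : TwoPlayerGame Q₁ Q₂ A₁ A₂) (w : ℝ) (δ : ℝ → ℝ)
    (qX qZ : Q₂) (fX fZ : A₂ → ℤˣ) : Prop where
  w_pos : 0 < w
  w_le_one : w ≤ 1
  δ_mapsTo : Set.MapsTo δ (Set.Icc 0 1) (Set.Icc 0 1)
  δ_continuous : ContinuousOn δ (Set.Icc 0 1)
  δ_zero : δ 0 = 0
  /-- No strategy has success probability larger than `w`; with the honest strategy of
  `complete`, the entangled value of `G` is `w`. -/
  optimal : ∀ (ι κ : Type) [Fintype ι] [DecidableEq ι] [Fintype κ] [DecidableEq κ]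
    (ψ : ι × κ → ℂ) (M : Q₁ → A₁ → Matrix ι ι ℂ) (N : Q₂ → A₂ → Matrix κ κ ℂ),
    l2norm ψ = 1 → (∀ q, IsPOVM (M q)) → (∀ r, IsPOVM (N r)) → G.success ψ M N ≤ w
  /-- An honest strategy: `k + 1` EPR pairs, projective measurements, success probability `w`, and
  the second player's observables for `qX`, `qZ` are `σ_X`, `σ_Z` on the first pair. -/
  complete : ∃ (k : ℕ)
    (M : Q₁ → A₁ → Matrix (Fin 2 × (Fin k → Fin 2)) (Fin 2 × (Fin k → Fin 2)) ℂ)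
    (N : Q₂ → A₂ → Matrix (Fin 2 × (Fin k → Fin 2)) (Fin 2 × (Fin k → Fin 2)) ℂ),
    (∀ q, IsProjective (M q)) ∧ (∀ r, IsProjective (N r)) ∧
    G.success (tensorState epr (eprPow k)) M N = w ∧
    signObs fX (N qX) = pauliX ⊗ₖ (1 : Matrix (Fin k → Fin 2) (Fin k → Fin 2) ℂ) ∧
    signObs fZ (N qZ) = pauliZ ⊗ₖ (1 : Matrix (Fin k → Fin 2) (Fin k → Fin 2) ℂ)
  /-- Soundness for projective strategies. `U` acts on the second player's space and `V` on the
  first player's space; operators on one space act as the identity on the other. -/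
  sound : ∀ (ι κ : Type) [Fintype ι] [DecidableEq ι] [Fintype κ] [DecidableEq κ]
    (ψ : ι × κ → ℂ) (M : Q₁ → A₁ → Matrix ι ι ℂ) (N : Q₂ → A₂ → Matrix κ κ ℂ),
    l2norm ψ = 1 → (∀ q, IsProjective (M q)) → (∀ r, IsProjective (N r)) →
    ∀ ε : ℝ, 0 < ε → ε ≤ 1 → w - ε ≤ G.success ψ M N →
    ∃ (d e : ℕ) (V : Matrix (Fin 2 × Fin d) ι ℂ) (U : Matrix (Fin 2 × Fin e) κ ℂ)
      (χ : Fin d × Fin e → ℂ),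
      IsIsometry V ∧ IsIsometry U ∧ l2norm χ = 1 ∧
      l2norm ((V ⊗ₖ U) *ᵥ ψ - tensorState epr χ) ≤ δ ε ∧
      l2norm (((1 : Matrix ι ι ℂ) ⊗ₖ signObs fX (N qX)
        - (1 : Matrix ι ι ℂ) ⊗ₖ (Uᴴ * (pauliX ⊗ₖ (1 : Matrix (Fin e) (Fin e) ℂ)) * U)) *ᵥ ψ)
          ≤ δ ε ∧
      l2norm (((1 : Matrix ι ι ℂ) ⊗ₖ signObs fZ (N qZ)
        - (Vᴴ * (pauliZ ⊗ₖ (1 : Matrix (Fin d) (Fin d) ℂ)) * V) ⊗ₖ (1 : Matrix κ κ ℂ)) *ᵥ ψ)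
          ≤ δ ε

end Games

/-- The two basis settings. -/
inductive BasisSetting
  | X
  | Z

/-- `n`-bit strings; `+` is the bitwise XOR and `⬝ᵥ` the inner product modulo `2`. -/
abbrev BitString (n : ℕ) : Type := Fin n → ZMod 2

/-- The lexicographic order on strings. -/
def lexLE {n : ℕ} (a b : BitString n) : Prop :=
  toLex (fun i => (a i).val) ≤ toLex (fun i => (b i).val)

/-- The set of pairs of strings `a`, `b` with `a · b = 1` modulo `2`. -/
def oddPairs (n : ℕ) : Finset (BitString n × BitString n) :=
  Finset.univ.filter fun p => p.1 ⬝ᵥ p.2 = 1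

section Test

variable {Q₁ Q₂ A₁ A₂ : Type} [Fintype Q₁] [Fintype Q₂] [Fintype A₁] [Fintype A₂]

/-- The measurements of one player in the test, on the Hilbert space `ℂ^ι`. A `W`-query carries a
basis and two strings in lexicographic order and is answered by two signs. A `G`-query carries a
question of the anticommutation game (of its first or of its second player), the string `a` that
goes with `X` and the string `b` that goes with `Z`. -/
structure PlayerMeas (n : ℕ) (Q₁ Q₂ A₁ A₂ ι : Type) [Fintype A₁] [Fintype A₂]
    [Fintype ι] [DecidableEq ι] where
  wMeas : BasisSetting → BitString n × BitString n → ℤˣ × ℤˣ → Matrix ι ι ℂ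
  gMeas₁ : Q₁ → BitString n → BitString n → A₁ → Matrix ι ι ℂ
  gMeas₂ : Q₂ → BitString n → BitString n → A₂ → Matrix ι ι ℂ
  wMeas_povm : ∀ W s, IsPOVM (wMeas W s)
  gMeas₁_povm : ∀ q a b, IsPOVM (gMeas₁ q a b)
  gMeas₂_povm : ∀ q a b, IsPOVM (gMeas₂ q a b)

open Classical in
/-- The measurement applied when the verifier sends the strings `a`, `b` (in lexicographic order)
in the basis `W`; in the outcome `(α, β)`, `α` is the answer associated with `a` and `β` the
answer associated with `b`. -/
def PlayerMeas.pair {n : ℕ} {ι : Type} [Fintype ι] [DecidableEq ι]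
    (P : PlayerMeas n Q₁ Q₂ A₁ A₂ ι) (W : BasisSetting) (a b : BitString n)
    (o : ℤˣ × ℤˣ) : Matrix ι ι ℂ :=
  if lexLE a b then P.wMeas W (a, b) o else P.wMeas W (b, a) (o.2, o.1)

variable {n : ℕ} {ι κ : Type} [Fintype ι] [DecidableEq ι] [Fintype κ] [DecidableEq κ]

/-- Acceptance probability of the linearity test in basis `W`. Alice receives uniformly random
`a`, `b`; Bob receives `c` and a uniformly random string `d`, where `c` is `a`, `b` or `a + b`
with probability `1/3` each. -/
def linearityProb (ψ : ι × κ → ℂ) (P : PlayerMeas n Q₁ Q₂ A₁ A₂ ι)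
    (R : PlayerMeas n Q₁ Q₂ A₁ A₂ κ) (W : BasisSetting) : ℝ :=
  𝔼 a : BitString n, 𝔼 b : BitString n, 𝔼 d : BitString n,
    ((1 / 3) * acceptProb ψ (P.pair W a b) (R.pair W a d) (fun x y => y.1 = x.1)
      + (1 / 3) * acceptProb ψ (P.pair W a b) (R.pair W b d) (fun x y => y.1 = x.2)
      + (1 / 3) * acceptProb ψ (P.pair W a b) (R.pair W (a + b) d)
          (fun x y => y.1 = x.1 * x.2))

/-- Acceptance probability of the anticommutation test: `G` is played on a uniformly random pair
`a`, `b` with `a · b = 1`, which both players receive. -/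
def anticommutationProb (G : TwoPlayerGame Q₁ Q₂ A₁ A₂) (ψ : ι × κ → ℂ)
    (P : PlayerMeas n Q₁ Q₂ A₁ A₂ ι) (R : PlayerMeas n Q₁ Q₂ A₁ A₂ κ) : ℝ :=
  𝔼 p ∈ oddPairs n,
    G.success ψ (fun q => P.gMeas₁ q p.1 p.2) (fun r => R.gMeas₂ r p.1 p.2)

/-- The decision in the first part of the consistency test: in basis `X`, and if Bob's question is
`qX`, Alice's answer associated with `a` must equal the `fX`-value of Bob's answer; in basis `Z`,
and if Bob's question is `qZ`, the same for her answer associated with `b` and `fZ`; in all other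
cases the verifier accepts. -/
def consistencyAccept (qX qZ : Q₂) (fX fZ : A₂ → ℤˣ) (r : Q₂) :
    BasisSetting → ℤˣ × ℤˣ → A₂ → Prop
  | .X => fun x y => r = qX → x.1 = fX y
  | .Z => fun x y => r = qZ → x.2 = fZ y

/-- Acceptance probability of the consistency test in basis `W`. Alice receives a uniformly random
pair `a`, `b` with `a · b = 1`. With probability `1/2`, Bob receives a question of the second
player of `G` together with `a`, `b`; with probability `1/2`, he receives `a` and a uniformly
random string `c`, and the product of the answers associated with `a` must be `1`. -/
def consistencyProb (G : TwoPlayerGame Q₁ Q₂ A₁ A₂) (qX qZ : Q₂) (fX fZ : A₂ → ℤˣ)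
    (ψ : ι × κ → ℂ) (P : PlayerMeas n Q₁ Q₂ A₁ A₂ ι) (R : PlayerMeas n Q₁ Q₂ A₁ A₂ κ)
    (W : BasisSetting) : ℝ :=
  𝔼 p ∈ oddPairs n,
    ((1 / 2) * ∑ r, G.secondProb r *
        acceptProb ψ (P.pair W p.1 p.2) (R.gMeas₂ r p.1 p.2) (consistencyAccept qX qZ fX fZ r W)
      + (1 / 2) * 𝔼 c : BitString n,
          acceptProb ψ (P.pair W p.1 p.2) (R.pair W p.1 c) (fun x y => x.1 * y.1 = 1))

/-- Success probability when the player with measurements `P` is labelled Alice and the one with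
measurements `R` is labelled Bob: the three subtests are performed with probability `1/3` each,
and the basis setting is uniformly random. -/
def labelledSuccess (G : TwoPlayerGame Q₁ Q₂ A₁ A₂) (qX qZ : Q₂) (fX fZ : A₂ → ℤˣ)
    (ψ : ι × κ → ℂ) (P : PlayerMeas n Q₁ Q₂ A₁ A₂ ι) (R : PlayerMeas n Q₁ Q₂ A₁ A₂ κ) : ℝ :=
  (1 / 3) * ((1 / 2) * linearityProb ψ P R .X + (1 / 2) * linearityProb ψ P R .Z)
    + (1 / 3) * anticommutationProb G ψ P R
    + (1 / 3) * ((1 / 2) * consistencyProb G qX qZ fX fZ ψ P R .X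
        + (1 / 2) * consistencyProb G qX qZ fX fZ ψ P R .Z)

/-- Success probability in the Pauli braiding test: the verifier labels one of the two players,
chosen uniformly at random, Alice and the other one Bob. -/
def braidingSuccess (G : TwoPlayerGame Q₁ Q₂ A₁ A₂) (qX qZ : Q₂) (fX fZ : A₂ → ℤˣ)
    (ψ : ι × κ → ℂ) (P : PlayerMeas n Q₁ Q₂ A₁ A₂ ι) (R : PlayerMeas n Q₁ Q₂ A₁ A₂ κ) : ℝ :=
  (1 / 2) * labelledSuccess G qX qZ fX fZ ψ P R
    + (1 / 2) * labelledSuccess G qX qZ fX fZ (fun p : κ × ι => ψ (p.2, p.1)) R P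

end Test

/-- The operator `⟨EPR|^{⊗ n} ⊗ Id`, where the bra acts on the two `n`-qubit registers. -/
def braEPR (n : ℕ) (K L : Type*) [DecidableEq K] [DecidableEq L] :
    Matrix (K × L) (((Fin n → Fin 2) × K) × ((Fin n → Fin 2) × L)) ℂ :=
  fun k p => if p.1.2 = k.1 ∧ p.2.2 = k.2 then star (eprPow n (p.1.1, p.2.1)) else 0

/-- The overlap `Tr((⟨EPR|^{⊗ n} ⊗ Id) (Φ_A ⊗ Φ_B)(|ψ⟩⟨ψ|) (|EPR⟩^{⊗ n} ⊗ Id))`. -/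
def eprOverlap {n : ℕ} {ι κ K L : Type*} [Fintype ι] [Fintype κ] [Fintype K] [Fintype L]
    [DecidableEq K] [DecidableEq L]
    (ΦA : Matrix ((Fin n → Fin 2) × K) ι ℂ) (ΦB : Matrix ((Fin n → Fin 2) × L) κ ℂ)
    (ψ : ι × κ → ℂ) : ℂ :=
  (braEPR n K L * ((ΦA ⊗ₖ ΦB) * density ψ * (ΦA ⊗ₖ ΦB)ᴴ) * (braEPR n K L)ᴴ).trace

end PauliBraiding

end

/-!
The proof gives the stronger bound `1 - overlap ≤ C ε`.

Only the labelling with `P` as Alice and `R` as Bob is needed: the other one succeeds with probability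
at most `2/3 + w/3`, so this one succeeds with probability at least `2/3 + w/3 - 2ε`, and each of its
subtests is within `O(ε)` of its optimum. By Naimark's theorem (`PlayerMeas.exists_dilation`) all
measurements may be assumed projective. Then `‖(F ⊗ 1 - 1 ⊗ G) ψ‖²` is four times the probability
that the signs `F` and `G` differ (`norm_sq_signObs_sub`), so that every subtest is a mean square
estimate on `ψ`.

* Linearity. The spectator strings can be fixed to good values, which leaves observables `X_A(a)`,
  `Z_A(b)` and `X_B(a)`, `Z_B(b)` that agree between the players and are linear in the string, up to
  mean square error `O(ε)` (`PlayerMeas.IsPVM.exists_linear`).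
* Anticommutation and consistency. In a nearly optimal strategy for `G` the special observables
  nearly anticommute (`IsAnticommutationGame.anticommute`), and the consistency test carries this
  over to `X_B(a)` and `Z_B(b)` when `a · b = 1`. This uses that the special questions have positive
  probability, which soundness forces (`IsAnticommutationGame.secondProb_pos`). If `a · b = 0` and
  `b ≠ 0`, then `a = p + q` with `p · b = q · b = 1`, and linearity turns two anticommutation
  relations into a commutation relation (`CommutingFamilies.expect_commutation`).

From these relations the swap isometry `swapIsometry` extracts the EPR pairs. The overlap is the
squared norm of the family `swapComponent`. Its inner product with the explicit unit family
`referenceComponent` is, by Fourier inversion over `𝔽₂ⁿ`, an average of the correlations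
`⟨Z_A(f) X_A(e) ψ, Z_A(b) X_A(a) Z_B(b+f) X_B(a+e) ψ⟩` with signs
(`sum_inner_referenceComponent`), and the approximate relations show that these are `1 - O(ε)` on
average (`CommutingFamilies.expect_braid`).
-/

namespace PauliBraiding

/-! ### Bit strings and signs -/

theorem add_self_bits {n : ℕ} (a : BitString n) : a + a = 0 := by
  funext i
  exact CharTwo.add_self_eq_zero (a i)

/-- The sign `(-1)^x`. -/
noncomputable def sgn (x : ZMod 2) : ℂ := if x = 1 then -1 else 1

theorem sgn_add (x y : ZMod 2) : sgn (x + y) = sgn x * sgn y := by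
  have h : ∀ x y : ZMod 2, (x + y = 1 ↔ ¬(x = 1 ↔ y = 1)) := by decide
  unfold sgn
  by_cases hx : x = 1 <;> by_cases hy : y = 1 <;> simp [h, hx, hy]

theorem sgn_zero : sgn 0 = 1 := by simp [sgn]

theorem sgn_one : sgn 1 = -1 := by simp [sgn]

theorem sgn_mul_self (x : ZMod 2) : sgn x * sgn x = 1 := by
  unfold sgn; split_ifs <;> simp

theorem norm_sgn (x : ZMod 2) : ‖sgn x‖ = 1 := by
  unfold sgn; split_ifs <;> simp

theorem star_sgn (x : ZMod 2) : star (sgn x) = sgn x := by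
  unfold sgn; split_ifs <;> simp

theorem eq_one_of_ne_zero_bit {x : ZMod 2} (h : x ≠ 0) : x = 1 := by
  revert x; decide

/-- Orthogonality of the characters of `𝔽₂ⁿ`. -/
theorem sum_sgn_dotProduct {n : ℕ} (b : BitString n) :
    ∑ t : BitString n, sgn (t ⬝ᵥ b) = if b = 0 then (2 : ℂ) ^ n else 0 := by
  split_ifs with h
  · subst h
    simp [sgn_zero, Fintype.card_pi]
  · obtain ⟨i, hi⟩ := Function.ne_iff.1 h
    have hi1 : b i = 1 := eq_one_of_ne_zero_bit hi
    have : ∑ t : BitString n, sgn (t ⬝ᵥ b) = ∑ t : BitString n, -sgn (t ⬝ᵥ b) := by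
      refine Fintype.sum_equiv (Equiv.addRight (Pi.single i 1)) _ _ fun t => ?_
      simp [add_dotProduct, sgn_add, hi1, sgn_one]
    rw [Finset.sum_neg_distrib] at this
    linear_combination this / 2

theorem card_bits (n : ℕ) : Fintype.card (BitString n) = 2 ^ n := by
  simp [Fintype.card_pi]

/-- Half of all strings have odd inner product with a given nonzero string. -/
theorem expect_odd {n : ℕ} {g : BitString n} (hg : g ≠ 0) :
    𝔼 p : BitString n, (if p ⬝ᵥ g = 1 then (1 : ℝ) else 0) = 1 / 2 := by
  have h := sum_sgn_dotProduct g
  rw [if_neg hg] at h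
  have h2 : ∀ p : BitString n, sgn (p ⬝ᵥ g)
      = ((1 - 2 * (if p ⬝ᵥ g = 1 then (1 : ℝ) else 0) : ℝ) : ℂ) := by
    intro p; unfold sgn; split_ifs <;> norm_num
  simp_rw [h2] at h
  rw [← Complex.ofReal_sum, Complex.ofReal_eq_zero, Finset.sum_sub_distrib, ← Finset.mul_sum] at h
  rw [Fintype.expect_eq_sum_div_card, card_bits]
  simp only [Finset.sum_const, Finset.card_univ, card_bits, nsmul_eq_mul, mul_one] at h
  have hN : (0 : ℝ) < ((2 ^ n : ℕ) : ℝ) := by positivity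
  rw [div_eq_iff hN.ne']
  linarith

/-! ### Approximate Pauli relations imply the braided swap relation -/

section Abstract

variable {E : Type*} [NormedAddCommGroup E] [InnerProductSpace ℂ E]

/-- A linear map that is a norm-preserving involution. -/
structure IsObs (A : E →ₗ[ℂ] E) : Prop where
  sq : ∀ v, A (A v) = v
  norm : ∀ v, ‖A v‖ = ‖v‖

theorem IsObs.dist {A : E →ₗ[ℂ] E} (h : IsObs A) (u v : E) : ‖A u - A v‖ = ‖u - v‖ := by
  rw [← map_sub, h.norm]

/-- Families of observables of two players that commute with each other, normalized at `0`. -/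
structure CommutingFamilies {n : ℕ} (XA ZA XB ZB : BitString n → E →ₗ[ℂ] E) : Prop where
  xA : ∀ a, IsObs (XA a)
  zA : ∀ a, IsObs (ZA a)
  xB : ∀ a, IsObs (XB a)
  zB : ∀ a, IsObs (ZB a)
  xx : ∀ a b v, XA a (XB b v) = XB b (XA a v)
  xz : ∀ a b v, XA a (ZB b v) = ZB b (XA a v)
  zx : ∀ a b v, ZA a (XB b v) = XB b (ZA a v)
  zz : ∀ a b v, ZA a (ZB b v) = ZB b (ZA a v)
  zB_zero : ∀ v, ZB 0 v = v

variable {n : ℕ} {XA ZA XB ZB : BitString n → E →ₗ[ℂ] E}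

/-- Two anticommutation relations give a commutation relation: if `p` and `q` both anticommute
with `g`, then `p + q` commutes with `g`, up to the errors in the approximate relations used. -/
theorem CommutingFamilies.commute_of_odd (h : CommutingFamilies XA ZA XB ZB) (ψ : E)
    (p q g : BitString n) :
    ‖ZB g (XB (p + q) ψ) - XB (p + q) (ZB g ψ)‖ ≤
      2 * ‖XB p (XB q ψ) - XB (p + q) ψ‖ + 2 * ‖XA q ψ - XB q ψ‖
      + ‖XB p (ZB g ψ) + ZB g (XB p ψ)‖ + ‖XB q (ZB g ψ) + ZB g (XB q ψ)‖
      + 2 * ‖ZA g ψ - ZB g ψ‖ := by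
  have h1 : ‖ZB g (XB (p + q) ψ) - ZB g (XB p (XB q ψ))‖ = ‖XB p (XB q ψ) - XB (p + q) ψ‖ := by
    rw [(h.zB g).dist, norm_sub_rev]
  have h2 : ‖ZB g (XB p (XB q ψ)) - ZB g (XB p (XA q ψ))‖ = ‖XA q ψ - XB q ψ‖ := by
    rw [(h.zB g).dist, (h.xB p).dist, norm_sub_rev]
  have h3 : ‖ZB g (XB p (XA q ψ)) - (-XB p (ZB g (XA q ψ)))‖
      = ‖XB p (ZB g ψ) + ZB g (XB p ψ)‖ := by
    rw [← h.xx, ← h.xz, ← h.xz, ← h.xx, sub_neg_eq_add, ← map_add, (h.xA q).norm, add_comm]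
  have h4 : ‖(-XB p (ZB g (XA q ψ))) - (-XB p (ZB g (XB q ψ)))‖ = ‖XA q ψ - XB q ψ‖ := by
    rw [← neg_sub', norm_neg, (h.xB p).dist, (h.zB g).dist]
  have h5 : ‖(-XB p (ZB g (XB q ψ))) - XB p (XB q (ZB g ψ))‖
      = ‖XB q (ZB g ψ) + ZB g (XB q ψ)‖ := by
    rw [← neg_add', norm_neg, ← map_add, (h.xB p).norm, add_comm]
  have h6 : ‖XB p (XB q (ZB g ψ)) - XB p (XB q (ZA g ψ))‖ = ‖ZA g ψ - ZB g ψ‖ := by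
    rw [(h.xB p).dist, (h.xB q).dist, norm_sub_rev]
  have h7 : ‖XB p (XB q (ZA g ψ)) - XB (p + q) (ZA g ψ)‖
      = ‖XB p (XB q ψ) - XB (p + q) ψ‖ := by
    rw [← h.zx, ← h.zx, ← h.zx, (h.zA g).dist]
  have h8 : ‖XB (p + q) (ZA g ψ) - XB (p + q) (ZB g ψ)‖ = ‖ZA g ψ - ZB g ψ‖ := by
    rw [(h.xB _).dist]
  have t1 := norm_sub_le_norm_sub_add_norm_sub (ZB g (XB (p + q) ψ)) (ZB g (XB p (XB q ψ)))
    (XB (p + q) (ZB g ψ))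
  have t2 := norm_sub_le_norm_sub_add_norm_sub (ZB g (XB p (XB q ψ))) (ZB g (XB p (XA q ψ)))
    (XB (p + q) (ZB g ψ))
  have t3 := norm_sub_le_norm_sub_add_norm_sub (ZB g (XB p (XA q ψ))) (-XB p (ZB g (XA q ψ)))
    (XB (p + q) (ZB g ψ))
  have t4 := norm_sub_le_norm_sub_add_norm_sub (-XB p (ZB g (XA q ψ))) (-XB p (ZB g (XB q ψ)))
    (XB (p + q) (ZB g ψ))
  have t5 := norm_sub_le_norm_sub_add_norm_sub (-XB p (ZB g (XB q ψ))) (XB p (XB q (ZB g ψ)))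
    (XB (p + q) (ZB g ψ))
  have t6 := norm_sub_le_norm_sub_add_norm_sub (XB p (XB q (ZB g ψ))) (XB p (XB q (ZA g ψ)))
    (XB (p + q) (ZB g ψ))
  have t7 := norm_sub_le_norm_sub_add_norm_sub (XB p (XB q (ZA g ψ))) (XB (p + q) (ZA g ψ))
    (XB (p + q) (ZB g ψ))
  linarith

/-- The vector `Z_A(b) X_A(a) Z_B(b+f) X_B(a+e) ψ` is close to `± Z_A(f) X_A(e) ψ`. -/
theorem CommutingFamilies.braid (h : CommutingFamilies XA ZA XB ZB) (ψ : E)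
    (a e b f : BitString n) :
    ‖ZA b (XA a (ZB (b + f) (XB (a + e) ψ))) - sgn (e ⬝ᵥ (b + f)) • ZA f (XA e ψ)‖ ≤
      ‖XA a ψ - XB a ψ‖ + ‖XB (a + e) (XB a ψ) - XB ((a + e) + a) ψ‖
      + ‖ZA b ψ - ZB b ψ‖ + ‖ZA f ψ - ZB f ψ‖ + ‖ZB b (ZB f ψ) - ZB (b + f) ψ‖
      + ‖ZB (b + f) (XB e ψ) - sgn (e ⬝ᵥ (b + f)) • XB e (ZB (b + f) ψ)‖
      + ‖XA e ψ - XB e ψ‖ := by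
  have hae : (a + e) + a = e := by rw [add_comm a e, add_assoc, add_self_bits, add_zero]
  rw [hae]
  set g := b + f with hg
  set s := sgn (e ⬝ᵥ g) with hs
  have hs2 : s * s = 1 := sgn_mul_self _
  have e1 : ZA b (XA a (ZB g (XB (a + e) ψ))) = ZA b (ZB g (XB (a + e) (XA a ψ))) := by
    rw [h.xz, h.xx]
  have h1 : ‖ZA b (ZB g (XB (a + e) (XA a ψ))) - ZA b (ZB g (XB (a + e) (XB a ψ)))‖
      = ‖XA a ψ - XB a ψ‖ := by
    rw [(h.zA b).dist, (h.zB g).dist, (h.xB _).dist]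
  have h2 : ‖ZA b (ZB g (XB (a + e) (XB a ψ))) - ZA b (ZB g (XB e ψ))‖
      = ‖XB (a + e) (XB a ψ) - XB e ψ‖ := by
    rw [(h.zA b).dist, (h.zB g).dist]
  have e2 : ZA b (ZB g (XB e ψ)) = ZA f (ZB g (XB e (ZA f (ZA b ψ)))) := by
    rw [h.zz, h.zx, h.zz, h.zx, (h.zA f).sq]
  have h3 : ‖ZA f (ZB g (XB e (ZA f (ZA b ψ)))) - ZA f (ZB g (XB e (ZA f (ZB b ψ))))‖
      = ‖ZA b ψ - ZB b ψ‖ := by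
    rw [(h.zA f).dist, (h.zB g).dist, (h.xB _).dist, (h.zA f).dist]
  have e3 : ZA f (ZB g (XB e (ZA f (ZB b ψ)))) = ZA f (ZB g (XB e (ZB b (ZA f ψ)))) := by
    rw [h.zz f b]
  have h4 : ‖ZA f (ZB g (XB e (ZB b (ZA f ψ)))) - ZA f (ZB g (XB e (ZB b (ZB f ψ))))‖
      = ‖ZA f ψ - ZB f ψ‖ := by
    rw [(h.zA f).dist, (h.zB g).dist, (h.xB _).dist, (h.zB b).dist]
  have h5 : ‖ZA f (ZB g (XB e (ZB b (ZB f ψ)))) - ZA f (ZB g (XB e (ZB g ψ)))‖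
      = ‖ZB b (ZB f ψ) - ZB g ψ‖ := by
    rw [(h.zA f).dist, (h.zB g).dist, (h.xB _).dist]
  have h6 : ‖ZA f (ZB g (XB e (ZB g ψ))) - s • ZA f (XB e ψ)‖
      = ‖ZB g (XB e ψ) - s • XB e (ZB g ψ)‖ := by
    have e6 : XB e (ZB g ψ) = s • s • XB e (ZB g ψ) := by rw [smul_smul, hs2, one_smul]
    rw [← map_smul, (h.zA f).dist, ← (h.zB g).dist, (h.zB g).sq, map_smul, norm_sub_rev]
    nth_rewrite 1 [e6]
    rw [← smul_sub, norm_smul, hs, norm_sgn, one_mul]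
  have h7 : ‖s • ZA f (XB e ψ) - s • ZA f (XA e ψ)‖ = ‖XA e ψ - XB e ψ‖ := by
    rw [← smul_sub, norm_smul, hs, norm_sgn, one_mul, (h.zA f).dist, norm_sub_rev]
  rw [e1]
  have t1 := norm_sub_le_norm_sub_add_norm_sub (ZA b (ZB g (XB (a + e) (XA a ψ))))
    (ZA b (ZB g (XB (a + e) (XB a ψ)))) (s • ZA f (XA e ψ))
  have t2 := norm_sub_le_norm_sub_add_norm_sub (ZA b (ZB g (XB (a + e) (XB a ψ))))
    (ZA b (ZB g (XB e ψ))) (s • ZA f (XA e ψ))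
  rw [e2] at t2 h2
  have t3 := norm_sub_le_norm_sub_add_norm_sub (ZA f (ZB g (XB e (ZA f (ZA b ψ)))))
    (ZA f (ZB g (XB e (ZA f (ZB b ψ))))) (s • ZA f (XA e ψ))
  rw [e3] at t3 h3
  have t4 := norm_sub_le_norm_sub_add_norm_sub (ZA f (ZB g (XB e (ZB b (ZA f ψ)))))
    (ZA f (ZB g (XB e (ZB b (ZB f ψ))))) (s • ZA f (XA e ψ))
  have t5 := norm_sub_le_norm_sub_add_norm_sub (ZA f (ZB g (XB e (ZB b (ZB f ψ)))))
    (ZA f (ZB g (XB e (ZB g ψ)))) (s • ZA f (XA e ψ))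
  have t6 := norm_sub_le_norm_sub_add_norm_sub (ZA f (ZB g (XB e (ZB g ψ))))
    (s • ZA f (XB e ψ)) (s • ZA f (XA e ψ))
  linarith

/-- The approximate Pauli relations, in mean square over uniformly random strings: consistency
between the players, linearity on the second player's side, and anticommutation on pairs with odd
inner product. -/
structure ApproxPauli (XA ZA XB ZB : BitString n → E →ₗ[ℂ] E) (ψ : E) (c : ℝ) : Prop where
  consX : 𝔼 a, ‖XA a ψ - XB a ψ‖ ^ 2 ≤ c
  consZ : 𝔼 a, ‖ZA a ψ - ZB a ψ‖ ^ 2 ≤ c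
  linX : 𝔼 a, 𝔼 b, ‖XB a (XB b ψ) - XB (a + b) ψ‖ ^ 2 ≤ c
  linZ : 𝔼 a, 𝔼 b, ‖ZB a (ZB b ψ) - ZB (a + b) ψ‖ ^ 2 ≤ c
  anti : 𝔼 a, 𝔼 b, (if a ⬝ᵥ b = 1 then ‖XB a (ZB b ψ) + ZB b (XB a ψ)‖ ^ 2 else 0) ≤ c

theorem expect_add_right (f : BitString n → ℝ) (c : BitString n) :
    𝔼 a, f (a + c) = 𝔼 a, f a :=
  Fintype.expect_equiv (Equiv.addRight c) _ _ fun _ => rfl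

theorem expect_sub_right (f : BitString n → ℝ) (c : BitString n) :
    𝔼 a, f (a - c) = 𝔼 a, f a :=
  Fintype.expect_equiv (Equiv.subRight c) _ _ fun _ => rfl

theorem expect_mono {ι : Type*} [Fintype ι] {f g : ι → ℝ} (h : ∀ i, f i ≤ g i) :
    𝔼 i, f i ≤ 𝔼 i, g i := Finset.expect_le_expect fun i _ => h i

theorem sq_le_of_le_sum5 {x a b c d e : ℝ} (hx : 0 ≤ x)
    (h : x ≤ 2 * a + 2 * b + c + d + 2 * e) :
    x ^ 2 ≤ 20 * (a ^ 2 + b ^ 2 + c ^ 2 + d ^ 2 + e ^ 2) := by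
  have h1 : x ^ 2 ≤ (2 * a + 2 * b + c + d + 2 * e) ^ 2 := pow_le_pow_left₀ hx h 2
  nlinarith [sq_nonneg (2 * a - 2 * b), sq_nonneg (2 * a - c), sq_nonneg (2 * a - d),
    sq_nonneg (2 * a - 2 * e), sq_nonneg (2 * b - c), sq_nonneg (2 * b - d),
    sq_nonneg (2 * b - 2 * e), sq_nonneg (c - d), sq_nonneg (c - 2 * e), sq_nonneg (d - 2 * e),
    sq_nonneg c, sq_nonneg d]

theorem sq_le_of_le_sum7 {x a b c d e f g : ℝ} (hx : 0 ≤ x)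
    (h : x ≤ a + b + c + d + e + f + g) :
    x ^ 2 ≤ 7 * (a ^ 2 + b ^ 2 + c ^ 2 + d ^ 2 + e ^ 2 + f ^ 2 + g ^ 2) := by
  have h1 : x ^ 2 ≤ (a + b + c + d + e + f + g) ^ 2 := pow_le_pow_left₀ hx h 2
  have h2 := sq_sum_le_card_mul_sum_sq (s := (Finset.univ : Finset (Fin 7)))
    (f := ![a, b, c, d, e, f, g])
  simp [Fin.sum_univ_succ] at h2
  linarith

/-- The (anti)commutation relation holds in mean square over all pairs of strings. -/
theorem CommutingFamilies.expect_commutation (h : CommutingFamilies XA ZA XB ZB) {ψ : E} {c : ℝ}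
    (hP : ApproxPauli XA ZA XB ZB ψ c) :
    𝔼 e, 𝔼 g, ‖ZB g (XB e ψ) - sgn (e ⬝ᵥ g) • XB e (ZB g ψ)‖ ^ 2 ≤ 201 * c := by
  set O : BitString n → BitString n → ℝ := fun a b =>
    if a ⬝ᵥ b = 1 then ‖XB a (ZB b ψ) + ZB b (XB a ψ)‖ ^ 2 else 0 with hO
  have hO0 : ∀ a b, 0 ≤ O a b := fun a b => by simp only [hO]; split_ifs <;> positivity
  set Lx : BitString n → BitString n → ℝ := fun a b => ‖XB a (XB b ψ) - XB (a + b) ψ‖ ^ 2 with hL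
  set Cx : BitString n → ℝ := fun a => ‖XA a ψ - XB a ψ‖ ^ 2 with hCx
  set Cz : BitString n → ℝ := fun a => ‖ZA a ψ - ZB a ψ‖ ^ 2 with hCz
  have key : ∀ e g, ‖ZB g (XB e ψ) - sgn (e ⬝ᵥ g) • XB e (ZB g ψ)‖ ^ 2 ≤
      O e g + 40 * 𝔼 p, (Lx p (e - p) + Cx (e - p) + O p g + O (e - p) g + Cz g) := by
    intro e g
    have hpos : 0 ≤ 𝔼 p, (Lx p (e - p) + Cx (e - p) + O p g + O (e - p) g + Cz g) := by
      refine Finset.expect_nonneg fun p _ => ?_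
      have := hO0 p g
      have := hO0 (e - p) g
      simp only [hL, hCx, hCz]
      positivity
    by_cases h1 : e ⬝ᵥ g = 1
    · have : O e g = ‖ZB g (XB e ψ) - sgn (e ⬝ᵥ g) • XB e (ZB g ψ)‖ ^ 2 := by
        simp only [hO, h1, if_true, sgn_one, neg_smul, one_smul, sub_neg_eq_add]
        rw [add_comm]
      rw [← this]
      linarith
    · have h0 : e ⬝ᵥ g = 0 := by
        by_contra h2
        exact h1 (eq_one_of_ne_zero_bit h2)
      rw [h0, sgn_zero, one_smul]
      by_cases hg : g = 0
      · subst hg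
        rw [h.zB_zero, h.zB_zero, sub_self, norm_zero]
        have := hO0 e 0
        nlinarith
      · set D := ‖ZB g (XB e ψ) - XB e (ZB g ψ)‖ ^ 2 with hD
        have h2 : 𝔼 p : BitString n, (if p ⬝ᵥ g = 1 then (1 : ℝ) else 0) * D
            ≤ 𝔼 p, 20 * (Lx p (e - p) + Cx (e - p) + O p g + O (e - p) g + Cz g) := by
          refine expect_mono fun p => ?_
          split_ifs with hp
          · have hq : (e - p) ⬝ᵥ g = 1 := by
              rw [sub_dotProduct, h0, hp]; decide
            have h3 := h.commute_of_odd ψ p (e - p) g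
            rw [add_sub_cancel] at h3
            have h4 := sq_le_of_le_sum5 (norm_nonneg _) h3
            simp only [hL, hCx, hCz, hO, hp, hq, if_true, one_mul, add_sub_cancel]
            exact h4
          · rw [zero_mul]
            have := hO0 p g
            have := hO0 (e - p) g
            simp only [hL, hCx, hCz]
            positivity
        rw [← Finset.expect_mul, expect_odd hg, ← Finset.mul_expect] at h2
        have := hO0 e g
        linarith
  refine (expect_mono fun e => expect_mono fun g => key e g).trans ?_
  have f1 : 𝔼 e : BitString n, 𝔼 g : BitString n, 𝔼 p, Lx p (e - p) = 𝔼 a, 𝔼 b, Lx a b := by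
    simp only [Fintype.expect_const]
    rw [Finset.expect_comm]
    exact Finset.expect_congr rfl fun p _ => expect_sub_right (fun e => Lx p e) p
  have f2 : 𝔼 e : BitString n, 𝔼 g : BitString n, 𝔼 p, Cx (e - p) = 𝔼 a, Cx a := by
    simp only [Fintype.expect_const]
    rw [Finset.expect_comm]
    simp only [expect_sub_right Cx, Fintype.expect_const]
  have f3 : 𝔼 e : BitString n, 𝔼 g : BitString n, 𝔼 p, O p g = 𝔼 a, 𝔼 b, O a b := by
    rw [Fintype.expect_const, Finset.expect_comm]
  have f4 : 𝔼 e : BitString n, 𝔼 g : BitString n, 𝔼 p, O (e - p) g = 𝔼 a, 𝔼 b, O a b := by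
    rw [Finset.expect_comm]
    rw [Finset.expect_comm (f := fun a b => O a b)]
    refine Finset.expect_congr rfl fun g _ => ?_
    rw [Finset.expect_comm]
    simp only [expect_sub_right (fun e => O e g), Fintype.expect_const]
  have f5 : 𝔼 e : BitString n, 𝔼 g : BitString n, 𝔼 p : BitString n, Cz g = 𝔼 a, Cz a := by
    simp only [Fintype.expect_const]
  simp only [Finset.expect_add_distrib, ← Finset.mul_expect, f1, f2, f3, f4, f5]
  have := hP.consX
  have := hP.consZ
  have := hP.linX
  have := hP.anti
  linarith

/-- Alice's operators act on `ψ` like Bob's, so on average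
`Z_A(b) X_A(a) Z_B(b+f) X_B(a+e) ψ` can be rearranged by Bob's linearity and (anti)commutation
relations into the braiding sign times `Z_A(f) X_A(e) ψ`. -/
theorem CommutingFamilies.expect_braid (h : CommutingFamilies XA ZA XB ZB) {ψ : E} {c : ℝ}
    (hP : ApproxPauli XA ZA XB ZB ψ c) :
    𝔼 a, 𝔼 e, 𝔼 b, 𝔼 f, ‖ZA b (XA a (ZB (b + f) (XB (a + e) ψ)))
      - sgn (e ⬝ᵥ (b + f)) • ZA f (XA e ψ)‖ ^ 2 ≤ 1449 * c := by
  set Lx : BitString n → BitString n → ℝ := fun a b => ‖XB a (XB b ψ) - XB (a + b) ψ‖ ^ 2 with hL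
  set Lz : BitString n → BitString n → ℝ := fun a b => ‖ZB a (ZB b ψ) - ZB (a + b) ψ‖ ^ 2 with hL
  set Cx : BitString n → ℝ := fun a => ‖XA a ψ - XB a ψ‖ ^ 2 with hCx
  set Cz : BitString n → ℝ := fun a => ‖ZA a ψ - ZB a ψ‖ ^ 2 with hCz
  set D : BitString n → BitString n → ℝ := fun e g =>
    ‖ZB g (XB e ψ) - sgn (e ⬝ᵥ g) • XB e (ZB g ψ)‖ ^ 2 with hD
  refine (expect_mono fun a => expect_mono fun e => expect_mono fun b => expect_mono fun f =>
    show _ ≤ 7 * (Cx a + Lx (a + e) a + Cz b + Cz f + Lz b f + D e (b + f) + Cx e) from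
      sq_le_of_le_sum7 (norm_nonneg _) (h.braid ψ a e b f)).trans ?_
  have f1 : 𝔼 a : BitString n, 𝔼 e, Lx (a + e) a = 𝔼 a, 𝔼 b, Lx a b := by
    rw [Finset.expect_comm (f := fun a b => Lx a b)]
    refine Finset.expect_congr rfl fun a _ => ?_
    simp_rw [add_comm a]
    exact expect_add_right (fun e => Lx e a) a
  have f2 : ∀ e, 𝔼 b : BitString n, 𝔼 f, D e (b + f) = 𝔼 g, D e g := by
    intro e
    rw [Finset.expect_comm]
    have : ∀ f, 𝔼 b, D e (b + f) = 𝔼 g, D e g := expect_add_right _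
    simp only [this, Fintype.expect_const]
  simp only [Finset.expect_add_distrib, ← Finset.mul_expect, Fintype.expect_const, f1, f2]
  have := hP.consX
  have := hP.consZ
  have := hP.linX
  have := hP.linZ
  have := h.expect_commutation hP
  linarith

end Abstract

/-! ### The overlap of the swapped state -/

/-- The Fourier transform over `𝔽₂ⁿ`, normalized as an average. -/
noncomputable def fourier {V : Type*} [AddCommGroup V] [Module ℂ V] {n : ℕ} (v : BitString n → V)
    (t : BitString n) : V :=
  ((2 : ℂ) ^ n)⁻¹ • ∑ b, sgn (t ⬝ᵥ b) • v b

theorem fourier_map {V W : Type*} [AddCommGroup V] [Module ℂ V] [AddCommGroup W] [Module ℂ W]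
    {n : ℕ} (A : V →ₗ[ℂ] W) (v : BitString n → V) (t : BitString n) :
    A (fourier v t) = fourier (fun b => A (v b)) t := by
  simp [fourier, map_sum, map_smul]

section Fourier

variable {E : Type*} [NormedAddCommGroup E] [InnerProductSpace ℂ E] {n : ℕ}

theorem sum_inner_fourier (u v : BitString n → E) :
    ∑ t, inner ℂ (fourier u t) (fourier v t) = ((2 : ℂ) ^ n)⁻¹ * ∑ b, inner ℂ (u b) (v b) := by
  have hN : (2 : ℂ) ^ n ≠ 0 := by positivity
  have h1 : ∀ t, inner ℂ (fourier u t) (fourier v t) = ((2 : ℂ) ^ n)⁻¹ * (((2 : ℂ) ^ n)⁻¹ *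
      ∑ b, ∑ d, sgn (t ⬝ᵥ (b + d)) * inner ℂ (u b) (v d)) := by
    intro t
    simp only [fourier, inner_smul_left, inner_smul_right, sum_inner, inner_sum, map_inv₀, map_pow,
      Complex.conj_ofNat, dotProduct_add, sgn_add]
    simp only [Finset.mul_sum]
    rw [Finset.sum_comm]
    refine Finset.sum_congr rfl fun b _ => Finset.sum_congr rfl fun d _ => ?_
    rw [starRingEnd_apply, star_sgn]
    ring
  simp_rw [h1]
  rw [← Finset.mul_sum, ← Finset.mul_sum]
  congr 1
  rw [Finset.sum_comm]
  simp_rw [Finset.sum_comm (s := (Finset.univ : Finset (BitString n)))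
    (f := fun t d => sgn (t ⬝ᵥ (_ + d)) * inner ℂ (u _) (v d))]
  rw [Finset.mul_sum]
  refine Finset.sum_congr rfl fun b _ => ?_
  rw [Finset.sum_eq_single b]
  · rw [← Finset.sum_mul, sum_sgn_dotProduct, if_pos (add_self_bits b), inv_mul_cancel_left₀ hN]
  · intro d _ hd
    rw [← Finset.sum_mul, sum_sgn_dotProduct, if_neg, zero_mul]
    intro h0
    apply hd
    calc d = (b + b) + d := by rw [add_self_bits, zero_add]
      _ = b := by rw [add_assoc, h0, add_zero]
  · simp

theorem sum_norm_fourier (u : BitString n → E) :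
    ∑ t, ‖fourier u t‖ ^ 2 = ((2 : ℝ) ^ n)⁻¹ * ∑ b, ‖u b‖ ^ 2 := by
  have h := sum_inner_fourier u u
  simp only [inner_self_eq_norm_sq_to_K] at h
  apply Complex.ofReal_injective
  push_cast
  exact h

/-- A product of two transforms at `t` and `t + e` is the transform of a twisted convolution. -/
theorem fourier_fourier (u : BitString n → BitString n → E) (t e : BitString n) :
    fourier (fun b => fourier (u b) (t + e)) t
      = fourier (fun g => ((2 : ℂ) ^ n)⁻¹ • ∑ b, sgn (e ⬝ᵥ (b + g)) • u b (b + g)) t := by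
  simp only [fourier, Finset.smul_sum]
  rw [Finset.sum_comm (f := fun g b => ((2 : ℂ) ^ n)⁻¹ • sgn (t ⬝ᵥ g) • ((2 : ℂ) ^ n)⁻¹ •
    sgn (e ⬝ᵥ (b + g)) • u b (b + g))]
  refine Finset.sum_congr rfl fun b _ => ?_
  refine Fintype.sum_equiv (Equiv.addLeft b) _ _ fun d => ?_
  have hb : b + (b + d) = d := by rw [← add_assoc, add_self_bits, zero_add]
  simp only [Equiv.coe_addLeft, hb, smul_smul]
  congr 1
  rw [add_dotProduct, dotProduct_add, sgn_add, sgn_add]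
  ring

variable {XA ZA XB ZB : BitString n → E →ₗ[ℂ] E}

/-- The components, in the register that is traced out, of the state which is left after projecting
the swapped registers of the two players onto EPR pairs. -/
noncomputable def swapComponent (XA ZA XB ZB : BitString n → E →ₗ[ℂ] E) (ψ : E)
    (t t' : BitString n) : E :=
  (((2 : ℂ) ^ n)⁻¹ * ((√(2 ^ n) : ℝ) : ℂ)⁻¹) • ∑ s, fourier (fun b => ZA b (XA (s + t)
    (fourier (fun d => ZB d (XB (s + t') ψ)) t'))) t

/-- The reference state against which `swapComponent` is tested. -/
noncomputable def referenceComponent (XA ZA : BitString n → E →ₗ[ℂ] E) (ψ : E)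
    (t t' : BitString n) : E :=
  ((√(2 ^ n) : ℝ) : ℂ)⁻¹ • fourier (fun f => ZA f (XA (t + t') ψ)) t

theorem sum_referenceComponent (hX : ∀ a, IsObs (XA a)) (hZ : ∀ a, IsObs (ZA a)) (ψ : E) :
    ∑ t, ∑ t', ‖referenceComponent XA ZA ψ t t'‖ ^ 2 = ‖ψ‖ ^ 2 := by
  have h1 : ∀ t t', ‖referenceComponent XA ZA ψ t t'‖ ^ 2
      = ((2 : ℝ) ^ n)⁻¹ * ‖fourier (fun f => ZA f (XA (t + t') ψ)) t‖ ^ 2 := by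
    intro t t'
    rw [referenceComponent, norm_smul, mul_pow, norm_inv, Complex.norm_real, inv_pow,
      Real.norm_of_nonneg (Real.sqrt_nonneg _), Real.sq_sqrt (by positivity)]
  have h2 : ∀ t : BitString n, ∑ t', ‖fourier (fun f => ZA f (XA (t + t') ψ)) t‖ ^ 2
      = ∑ e, ‖fourier (fun f => ZA f (XA e ψ)) t‖ ^ 2 := fun t =>
    Fintype.sum_equiv (Equiv.addLeft t) _ _ fun _ => rfl
  simp_rw [h1, ← Finset.mul_sum, h2]
  rw [Finset.sum_comm]
  simp_rw [sum_norm_fourier, (hZ _).norm, (hX _).norm]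
  simp

/-- The overlap of the two families of components is an average of correlations. -/
theorem sum_inner_referenceComponent (ψ : E) :
    ∑ t, ∑ t', inner ℂ (referenceComponent XA ZA ψ t t') (swapComponent XA ZA XB ZB ψ t t')
      = 𝔼 a, 𝔼 e, 𝔼 b, 𝔼 f, inner ℂ (sgn (e ⬝ᵥ (b + f)) • ZA f (XA e ψ))
          (ZA b (XA a (ZB (b + f) (XB (a + e) ψ)))) := by
  have hN : (2 : ℂ) ^ n ≠ 0 := by positivity
  set N := (2 : ℂ) ^ n with hNdef
  have hsq : ((√(2 ^ n) : ℝ) : ℂ)⁻¹ * ((√(2 ^ n) : ℝ) : ℂ)⁻¹ = N⁻¹ := by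
    rw [← mul_inv, ← Complex.ofReal_mul, Real.mul_self_sqrt (by positivity)]
    simp [hNdef]
  -- the components at `t, t + e`, with the summation variable `s = a + t`
  have h1 : ∀ t e, inner ℂ (referenceComponent XA ZA ψ t (t + e))
      (swapComponent XA ZA XB ZB ψ t (t + e)) = N⁻¹ * N⁻¹ * ∑ a,
        inner ℂ (fourier (fun f => ZA f (XA e ψ)) t) (fourier (fun g => N⁻¹ • ∑ b,
          sgn (e ⬝ᵥ (b + g)) • ZA b (XA a (ZB (b + g) (XB (a + e) ψ)))) t) := by
    intro t e
    have ht : t + (t + e) = e := by rw [← add_assoc, add_self_bits, zero_add]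
    rw [referenceComponent, swapComponent, inner_smul_left, inner_smul_right, ht, map_inv₀,
      Complex.conj_ofReal, inner_sum, ← mul_assoc]
    congr 1
    · rw [← hsq]; ring
    · refine Fintype.sum_equiv (Equiv.addRight t) _ _ fun s => ?_
      rw [← fourier_fourier (fun b d => ZA b (XA (Equiv.addRight t s) (ZB d
        (XB (Equiv.addRight t s + e) ψ))))]
      simp only [fourier_map, Equiv.coe_addRight, add_assoc]
  have h2 : ∑ t, ∑ t', inner ℂ (referenceComponent XA ZA ψ t t')
        (swapComponent XA ZA XB ZB ψ t t')
      = ∑ t, ∑ e, inner ℂ (referenceComponent XA ZA ψ t (t + e))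
        (swapComponent XA ZA XB ZB ψ t (t + e)) :=
    Finset.sum_congr rfl fun t _ => (Fintype.sum_equiv (Equiv.addLeft t) _ _ fun _ => rfl).symm
  rw [h2]
  simp_rw [h1, ← Finset.mul_sum]
  rw [Finset.sum_comm]
  simp_rw [Finset.sum_comm (s := (Finset.univ : Finset (BitString n)))
    (f := fun t a => inner ℂ (fourier (fun f => ZA f (XA _ ψ)) t) (fourier (fun g => N⁻¹ • ∑ b,
          sgn (_ ⬝ᵥ (b + g)) • ZA b (XA a (ZB (b + g) (XB (a + _) ψ)))) t))]
  simp_rw [sum_inner_fourier]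
  simp only [Fintype.expect_eq_sum_div_card, card_bits, inner_smul_right, inner_smul_left, inner_sum]
  rw [Finset.sum_comm]
  simp only [Nat.cast_pow, Nat.cast_ofNat, ← hNdef, div_eq_mul_inv, Finset.mul_sum, Finset.sum_mul]
  refine Finset.sum_congr rfl fun a _ => Finset.sum_congr rfl fun e _ => ?_
  rw [Finset.sum_comm]
  refine Finset.sum_congr rfl fun b _ => Finset.sum_congr rfl fun f _ => ?_
  rw [starRingEnd_apply, star_sgn]
  ring

theorem re_inner_of_norm_one {u v : E} (hu : ‖u‖ = 1) (hv : ‖v‖ = 1) :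
    (inner ℂ u v).re = 1 - ‖v - u‖ ^ 2 / 2 := by
  have h := @norm_sub_sq ℂ _ _ _ _ u v
  rw [norm_sub_rev, hu, hv] at h
  simp only [RCLike.re_to_complex] at h
  linarith

/-- Under the approximate Pauli relations, the swapped registers are close to EPR pairs. -/
theorem CommutingFamilies.le_sum_swapComponent (h : CommutingFamilies XA ZA XB ZB) {ψ : E} {c : ℝ}
    (hψ : ‖ψ‖ = 1) (hP : ApproxPauli XA ZA XB ZB ψ c) :
    1 - 1449 * c ≤ ∑ t, ∑ t', ‖swapComponent XA ZA XB ZB ψ t t'‖ ^ 2 := by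
  have h1 : ∀ t t', 2 * (inner ℂ (referenceComponent XA ZA ψ t t')
      (swapComponent XA ZA XB ZB ψ t t')).re - ‖referenceComponent XA ZA ψ t t'‖ ^ 2
      ≤ ‖swapComponent XA ZA XB ZB ψ t t'‖ ^ 2 := by
    intro t t'
    have h2 := @norm_sub_sq ℂ _ _ _ _ (referenceComponent XA ZA ψ t t')
      (swapComponent XA ZA XB ZB ψ t t')
    simp only [RCLike.re_to_complex] at h2
    nlinarith [sq_nonneg ‖referenceComponent XA ZA ψ t t' - swapComponent XA ZA XB ZB ψ t t'‖]
  have h3 : (∑ t, ∑ t', inner ℂ (referenceComponent XA ZA ψ t t')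
      (swapComponent XA ZA XB ZB ψ t t')).re ≥ 1 - 1449 * c / 2 := by
    rw [sum_inner_referenceComponent]
    have h4 : ∀ f : BitString n → ℂ, (𝔼 a, f a).re = 𝔼 a, (f a).re := by
      intro f
      rw [Fintype.expect_eq_sum_div_card, Fintype.expect_eq_sum_div_card, Complex.div_natCast_re,
        Complex.re_sum]
    simp_rw [h4]
    have h5 : ∀ a e b f : BitString n, (inner ℂ (sgn (e ⬝ᵥ (b + f)) • ZA f (XA e ψ))
        (ZA b (XA a (ZB (b + f) (XB (a + e) ψ))))).re
        = 1 - ‖ZA b (XA a (ZB (b + f) (XB (a + e) ψ)))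
      - sgn (e ⬝ᵥ (b + f)) • ZA f (XA e ψ)‖ ^ 2 / 2 := by
      intro a e b f
      apply re_inner_of_norm_one
      · rw [norm_smul, norm_sgn, one_mul, (h.zA _).norm, (h.xA _).norm, hψ]
      · rw [(h.zA _).norm, (h.xA _).norm, (h.zB _).norm, (h.xB _).norm, hψ]
    simp_rw [h5, Finset.expect_sub_distrib, ← Finset.expect_div, Fintype.expect_const]
    have := h.expect_braid hP
    linarith
  calc 1 - 1449 * c ≤ 2 * (∑ t, ∑ t', inner ℂ (referenceComponent XA ZA ψ t t')
      (swapComponent XA ZA XB ZB ψ t t')).re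
        - ∑ t, ∑ t', ‖referenceComponent XA ZA ψ t t'‖ ^ 2 := by
        rw [sum_referenceComponent h.xA h.zA, hψ]; linarith
    _ = ∑ t, ∑ t', (2 * (inner ℂ (referenceComponent XA ZA ψ t t')
      (swapComponent XA ZA XB ZB ψ t t')).re - ‖referenceComponent XA ZA ψ t t'‖ ^ 2) := by
        simp only [Finset.sum_sub_distrib, Complex.re_sum, Finset.mul_sum]
    _ ≤ _ := Finset.sum_le_sum fun t _ => Finset.sum_le_sum fun t' _ => h1 t t'

end Fourier

/-! ### Matrices as operators on Euclidean spaces -/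

section Operators

variable {m k l : Type*} [Fintype m] [DecidableEq m] [Fintype k] [DecidableEq k]
  [Fintype l] [DecidableEq l]

/-- A matrix as a linear map between Euclidean spaces. -/
noncomputable def op (M : Matrix m k ℂ) : EuclideanSpace ℂ k →ₗ[ℂ] EuclideanSpace ℂ m :=
  Matrix.toLpLin 2 2 M

theorem op_toLp (M : Matrix m k ℂ) (v : k → ℂ) : op M (WithLp.toLp 2 v) = WithLp.toLp 2 (M *ᵥ v) :=
  rfl

theorem op_mul (M : Matrix m k ℂ) (N : Matrix k l ℂ) (v : EuclideanSpace ℂ l) :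
    op (M * N) v = op M (op N v) := by
  obtain ⟨v⟩ := v
  simp only [op_toLp, Matrix.mulVec_mulVec]

theorem op_one (v : EuclideanSpace ℂ m) : op (1 : Matrix m m ℂ) v = v := by
  obtain ⟨v⟩ := v
  simp only [op_toLp, Matrix.one_mulVec]

theorem op_add (M N : Matrix m k ℂ) (v : EuclideanSpace ℂ k) : op (M + N) v = op M v + op N v := by
  simp [op]

theorem op_neg (M : Matrix m k ℂ) (v : EuclideanSpace ℂ k) : op (-M) v = -op M v := by
  simp [op]

theorem inner_op_left (M : Matrix m k ℂ) (v : EuclideanSpace ℂ k) (w : EuclideanSpace ℂ m) :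
    inner ℂ (op M v) w = inner ℂ v (op Mᴴ w) := by
  obtain ⟨v⟩ := v
  obtain ⟨w⟩ := w
  simp only [op_toLp, EuclideanSpace.inner_eq_star_dotProduct]
  rw [Matrix.star_mulVec, dotProduct_comm, ← Matrix.dotProduct_mulVec, dotProduct_comm]

theorem norm_op_of_isIsometry {U : Matrix m k ℂ} (hU : IsIsometry U) (v : EuclideanSpace ℂ k) :
    ‖op U v‖ = ‖v‖ := by
  have h : inner ℂ (op U v) (op U v) = inner ℂ v v := by
    rw [inner_op_left, ← op_mul, hU, op_one]
  rw [inner_self_eq_norm_sq_to_K, inner_self_eq_norm_sq_to_K] at h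
  have h2 : ‖op U v‖ ^ 2 = ‖v‖ ^ 2 := by
    apply Complex.ofReal_injective
    push_cast
    exact h
  exact (pow_left_inj₀ (norm_nonneg _) (norm_nonneg _) two_ne_zero).1 h2

theorem norm_op_conjTranspose_le {U : Matrix m k ℂ} (hU : IsIsometry U) (v : EuclideanSpace ℂ m) :
    ‖op Uᴴ v‖ ≤ ‖v‖ := by
  have h : ‖op Uᴴ v‖ * ‖op Uᴴ v‖ ≤ ‖v‖ * ‖op Uᴴ v‖ := by
    calc ‖op Uᴴ v‖ * ‖op Uᴴ v‖ = ‖inner ℂ (op Uᴴ v) (op Uᴴ v)‖ := by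
          rw [inner_self_eq_norm_sq_to_K, norm_pow, RCLike.norm_ofReal, abs_norm, sq]
      _ = ‖inner ℂ v (op U (op Uᴴ v))‖ := by
          rw [inner_op_left, Matrix.conjTranspose_conjTranspose]
      _ ≤ ‖v‖ * ‖op U (op Uᴴ v)‖ := norm_inner_le_norm _ _
      _ = ‖v‖ * ‖op Uᴴ v‖ := by rw [norm_op_of_isIsometry hU]
  by_cases h0 : ‖op Uᴴ v‖ = 0
  · rw [h0]; exact norm_nonneg _
  · exact le_of_mul_le_mul_right h (lt_of_le_of_ne (norm_nonneg _) (Ne.symm h0))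

theorem isIsometry_of_norm {U : Matrix m k ℂ} (hU : ∀ v, ‖op U v‖ = ‖v‖) : IsIsometry U := by
  have h : op (Uᴴ * U) = LinearMap.id := by
    rw [← ext_inner_map]
    intro v
    rw [op_mul, ← inner_conj_symm, ← inner_op_left, LinearMap.id_apply, inner_self_eq_norm_sq_to_K,
      inner_self_eq_norm_sq_to_K, hU]
    simp
  rw [← Matrix.toLpLin_one (R := ℂ) (n := k) (p := 2)] at h
  exact (Matrix.toLpLin 2 2).injective h

/-- A Hermitian involution. -/
structure IsReflection (M : Matrix m m ℂ) : Prop where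
  herm : Mᴴ = M
  sq : M * M = 1

theorem IsReflection.isObs {M : Matrix m m ℂ} (h : IsReflection M) : IsObs (op M) where
  sq v := by rw [← op_mul, h.sq, op_one]
  norm := norm_op_of_isIsometry (by rw [IsIsometry, h.herm, h.sq])

theorem isReflection_one : IsReflection (1 : Matrix m m ℂ) := ⟨by simp, by simp⟩

theorem IsReflection.mul_of_commute {M N : Matrix m m ℂ} (hM : IsReflection M)
    (hN : IsReflection N) (h : M * N = N * M) : IsReflection (M * N) where
  herm := by rw [Matrix.conjTranspose_mul, hM.herm, hN.herm, h]
  sq := by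
    calc M * N * (M * N) = M * (N * M) * N := by noncomm_ring
      _ = (M * M) * (N * N) := by rw [← h]; noncomm_ring
      _ = 1 := by rw [hM.sq, hN.sq, mul_one]

theorem op_fourier {n : ℕ} (Z : BitString n → Matrix m m ℂ) (t : BitString n)
    (v : EuclideanSpace ℂ m) : op (fourier Z t) v = fourier (fun b => op (Z b) v) t :=
  fourier_map ((LinearMap.applyₗ v).comp (Matrix.toLpLin 2 2).toLinearMap) Z t

variable {ι κ : Type*} [Fintype ι] [DecidableEq ι] [Fintype κ] [DecidableEq κ]

/-- An operator of the first player on the joint space. -/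
noncomputable def leftOp (κ : Type*) [Fintype κ] [DecidableEq κ] (M : Matrix ι ι ℂ) :
    EuclideanSpace ℂ (ι × κ) →ₗ[ℂ] EuclideanSpace ℂ (ι × κ) :=
  op (M ⊗ₖ (1 : Matrix κ κ ℂ))

/-- An operator of the second player on the joint space. -/
noncomputable def rightOp (ι : Type*) [Fintype ι] [DecidableEq ι] (N : Matrix κ κ ℂ) :
    EuclideanSpace ℂ (ι × κ) →ₗ[ℂ] EuclideanSpace ℂ (ι × κ) :=
  op ((1 : Matrix ι ι ℂ) ⊗ₖ N)

theorem leftOp_rightOp (M : Matrix ι ι ℂ) (N : Matrix κ κ ℂ) (v : EuclideanSpace ℂ (ι × κ)) :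
    leftOp κ M (rightOp ι N v) = op (M ⊗ₖ N) v := by
  rw [leftOp, rightOp, ← op_mul, ← Matrix.mul_kronecker_mul, mul_one, one_mul]

theorem rightOp_leftOp (M : Matrix ι ι ℂ) (N : Matrix κ κ ℂ) (v : EuclideanSpace ℂ (ι × κ)) :
    rightOp ι N (leftOp κ M v) = op (M ⊗ₖ N) v := by
  rw [leftOp, rightOp, ← op_mul, ← Matrix.mul_kronecker_mul, mul_one, one_mul]

theorem leftOp_rightOp_comm (M : Matrix ι ι ℂ) (N : Matrix κ κ ℂ)
    (v : EuclideanSpace ℂ (ι × κ)) :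
    leftOp κ M (rightOp ι N v) = rightOp ι N (leftOp κ M v) := by
  rw [leftOp_rightOp, rightOp_leftOp]

theorem leftOp_mul (M N : Matrix ι ι ℂ) (v : EuclideanSpace ℂ (ι × κ)) :
    leftOp κ (M * N) v = leftOp κ M (leftOp κ N v) := by
  rw [leftOp, leftOp, leftOp, ← op_mul, ← Matrix.mul_kronecker_mul, mul_one]

theorem rightOp_mul (M N : Matrix κ κ ℂ) (v : EuclideanSpace ℂ (ι × κ)) :
    rightOp ι (M * N) v = rightOp ι M (rightOp ι N v) := by
  rw [rightOp, rightOp, rightOp, ← op_mul, ← Matrix.mul_kronecker_mul, mul_one]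

theorem leftOp_one (v : EuclideanSpace ℂ (ι × κ)) : leftOp κ (1 : Matrix ι ι ℂ) v = v := by
  rw [leftOp, Matrix.one_kronecker_one, op_one]

theorem rightOp_one (v : EuclideanSpace ℂ (ι × κ)) : rightOp ι (1 : Matrix κ κ ℂ) v = v := by
  rw [rightOp, Matrix.one_kronecker_one, op_one]

theorem IsReflection.isObs_leftOp {M : Matrix ι ι ℂ} (h : IsReflection M) :
    IsObs (leftOp κ M) := by
  refine IsReflection.isObs ⟨?_, ?_⟩
  · rw [Matrix.conjTranspose_kronecker, h.herm, Matrix.conjTranspose_one]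
  · rw [← Matrix.mul_kronecker_mul, h.sq, one_mul, Matrix.one_kronecker_one]

theorem IsReflection.isObs_rightOp {N : Matrix κ κ ℂ} (h : IsReflection N) :
    IsObs (rightOp ι N) := by
  refine IsReflection.isObs ⟨?_, ?_⟩
  · rw [Matrix.conjTranspose_kronecker, h.herm, Matrix.conjTranspose_one]
  · rw [← Matrix.mul_kronecker_mul, h.sq, one_mul, Matrix.one_kronecker_one]

/-- `leftOp` as a linear function of the matrix, applied to a vector. -/
noncomputable def leftOpₗ (v : EuclideanSpace ℂ (ι × κ)) :
    Matrix ι ι ℂ →ₗ[ℂ] EuclideanSpace ℂ (ι × κ) where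
  toFun M := leftOp κ M v
  map_add' M N := by rw [leftOp, Matrix.add_kronecker, op_add]; rfl
  map_smul' c M := by simp [leftOp, op, Matrix.smul_kronecker]

/-- `rightOp` as a linear function of the matrix, applied to a vector. -/
noncomputable def rightOpₗ (v : EuclideanSpace ℂ (ι × κ)) :
    Matrix κ κ ℂ →ₗ[ℂ] EuclideanSpace ℂ (ι × κ) where
  toFun N := rightOp ι N v
  map_add' M N := by rw [rightOp, Matrix.kronecker_add, op_add]; rfl
  map_smul' c M := by simp [rightOp, op, Matrix.kronecker_smul]

theorem leftOp_fourier {n : ℕ} (Z : BitString n → Matrix ι ι ℂ) (t : BitString n)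
    (v : EuclideanSpace ℂ (ι × κ)) :
    leftOp κ (fourier Z t) v = fourier (fun b => leftOp κ (Z b) v) t :=
  fourier_map (leftOpₗ v) Z t

theorem rightOp_fourier {n : ℕ} (Z : BitString n → Matrix κ κ ℂ) (t : BitString n)
    (v : EuclideanSpace ℂ (ι × κ)) :
    rightOp ι (fourier Z t) v = fourier (fun b => rightOp ι (Z b) v) t :=
  fourier_map (rightOpₗ v) Z t

end Operators

/-! ### Overlap with EPR pairs -/

section Overlap

variable {n : ℕ} {ι κ K L : Type*} [Fintype ι] [Fintype κ] [Fintype K] [Fintype L]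
  [DecidableEq ι] [DecidableEq κ] [DecidableEq K] [DecidableEq L]

theorem eprPow_apply (s s' : Fin n → Fin 2) :
    eprPow n (s, s') = if s = s' then ((√(2 ^ n) : ℝ) : ℂ)⁻¹ else 0 := by
  unfold eprPow epr
  split_ifs with h
  · subst h
    have : √((2 : ℝ) ^ n) = √2 ^ n := by
      rw [Real.sqrt_eq_iff_mul_self_eq (by positivity) (by positivity), ← mul_pow,
        Real.mul_self_sqrt (by norm_num)]
    rw [this]
    simp
  · obtain ⟨i, hi⟩ := Function.ne_iff.1 h
    exact Finset.prod_eq_zero (Finset.mem_univ i) (by simp [hi])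

theorem braEPR_mulVec (φ : ((Fin n → Fin 2) × K) × ((Fin n → Fin 2) × L) → ℂ) (x : K × L) :
    (braEPR n K L *ᵥ φ) x
      = ((√(2 ^ n) : ℝ) : ℂ)⁻¹ * ∑ s, φ ((s, x.1), (s, x.2)) := by
  simp only [Matrix.mulVec, dotProduct, braEPR, Fintype.sum_prod_type, eprPow_apply]
  rw [Finset.mul_sum]
  refine Finset.sum_congr rfl fun s _ => ?_
  rw [Finset.sum_eq_single x.1, Finset.sum_eq_single s, Finset.sum_eq_single x.2]
  · simp
  · intro l _ hl; simp [hl]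
  · simp
  · intro s' _ hs'; simp [hs'.symm]
  · simp
  · intro k _ hk; simp [hk]
  · simp

theorem isIsometry_braEPR : IsIsometry (braEPR n K L)ᴴ := by
  unfold IsIsometry
  rw [Matrix.conjTranspose_conjTranspose]
  ext x y
  change (braEPR n K L *ᵥ fun p => star (braEPR n K L y p)) x = _
  rw [braEPR_mulVec]
  have h : ∀ s : Fin n → Fin 2, star (braEPR n K L y ((s, x.1), (s, x.2)))
      = if x = y then ((√(2 ^ n) : ℝ) : ℂ)⁻¹ else 0 := by
    intro s
    simp only [braEPR, eprPow_apply, if_true, Prod.ext_iff]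
    split_ifs <;> simp
  have hsq : ((√(2 ^ n) : ℝ) : ℂ) * ((√(2 ^ n) : ℝ) : ℂ) = 2 ^ n := by
    rw [← Complex.ofReal_mul, Real.mul_self_sqrt (by positivity)]
    simp
  have h0 : ((√(2 ^ n) : ℝ) : ℂ) ≠ 0 := by
    intro h0
    rw [h0, mul_zero] at hsq
    exact absurd hsq.symm (by positivity)
  simp only [h, Finset.sum_const, Finset.card_univ, Fintype.card_pi, Fintype.card_fin,
    Finset.prod_const, nsmul_eq_mul, Matrix.one_apply]
  split_ifs
  · push_cast
    rw [← hsq]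
    field_simp
  · simp

theorem eprOverlap_eq (ΦA : Matrix ((Fin n → Fin 2) × K) ι ℂ)
    (ΦB : Matrix ((Fin n → Fin 2) × L) κ ℂ) (ψ : ι × κ → ℂ) :
    eprOverlap ΦA ΦB ψ
      = ((‖op (braEPR n K L) (op (ΦA ⊗ₖ ΦB) (WithLp.toLp 2 ψ))‖ ^ 2 : ℝ) : ℂ) := by
  have h1 : ∀ v : K × L → ℂ, (Matrix.vecMulVec v (star v)).trace
      = ((‖WithLp.toLp 2 v‖ ^ 2 : ℝ) : ℂ) := by
    intro v
    rw [EuclideanSpace.norm_sq_eq, Matrix.trace_vecMulVec]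
    simp only [dotProduct, Pi.star_apply, Complex.ofReal_sum]
    exact Finset.sum_congr rfl fun x _ => by
      rw [Complex.star_def, Complex.mul_conj, Complex.normSq_eq_norm_sq]
  rw [op_toLp, op_toLp, ← h1, eprOverlap, density]
  congr 1
  rw [Matrix.mul_vecMulVec, Matrix.vecMulVec_mul, Matrix.mul_vecMulVec, Matrix.vecMulVec_mul,
    ← Matrix.star_mulVec, ← Matrix.star_mulVec]

theorem eprOverlap_mul {ι' κ' : Type*} [Fintype ι'] [Fintype κ'] [DecidableEq ι'] [DecidableEq κ']
    (ΦA : Matrix ((Fin n → Fin 2) × K) ι ℂ)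
    (ΦB : Matrix ((Fin n → Fin 2) × L) κ ℂ) (JA : Matrix ι ι' ℂ) (JB : Matrix κ κ' ℂ)
    (ψ : ι' × κ' → ℂ) :
    eprOverlap (ΦA * JA) (ΦB * JB) ψ = eprOverlap ΦA ΦB ((JA ⊗ₖ JB) *ᵥ ψ) := by
  rw [eprOverlap_eq, eprOverlap_eq, Matrix.mul_kronecker_mul, op_mul]
  rfl

theorem eprOverlap_reindex {K' L' : Type*} [Fintype K'] [Fintype L'] [DecidableEq K']
    [DecidableEq L'] (e : K' ≃ K) (f : L' ≃ L) (ΦA : Matrix ((Fin n → Fin 2) × K) ι ℂ)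
    (ΦB : Matrix ((Fin n → Fin 2) × L) κ ℂ) (ψ : ι × κ → ℂ) :
    eprOverlap (ΦA.submatrix (Prod.map id e) id) (ΦB.submatrix (Prod.map id f) id) ψ
      = eprOverlap ΦA ΦB ψ := by
  rw [eprOverlap_eq, eprOverlap_eq]
  congr 1
  simp only [op_toLp, EuclideanSpace.norm_sq_eq]
  refine Fintype.sum_equiv (Equiv.prodCongr e f) _ _ fun x => ?_
  simp only [braEPR_mulVec]
  rfl

theorem isIsometry_reindex {K' : Type*} [Fintype K'] [DecidableEq K'] (e : K' ≃ K)
    {Φ : Matrix ((Fin n → Fin 2) × K) ι ℂ} (h : IsIsometry Φ) :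
    IsIsometry (Φ.submatrix (Prod.map id e) id) := by
  have := Matrix.submatrix_mul_equiv Φᴴ Φ id (Equiv.prodCongr (Equiv.refl (Fin n → Fin 2)) e) id
  unfold IsIsometry at h ⊢
  rw [h] at this
  rw [Matrix.conjTranspose_submatrix]
  simpa using this

theorem isIsometry_kronecker {a b c d : Type*} [Fintype a] [Fintype b] [Fintype c] [Fintype d]
    [DecidableEq b] [DecidableEq d] {U : Matrix a b ℂ} {V : Matrix c d ℂ}
    (hU : IsIsometry U) (hV : IsIsometry V) : IsIsometry (U ⊗ₖ V) := by
  unfold IsIsometry at *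
  rw [Matrix.conjTranspose_kronecker, ← Matrix.mul_kronecker_mul, hU, hV,
    Matrix.one_kronecker_one]

theorem isIsometry_mul {a b c : Type*} [Fintype a] [Fintype b] [DecidableEq b] [DecidableEq c]
    {U : Matrix a b ℂ} {V : Matrix b c ℂ}
    (hU : IsIsometry U) (hV : IsIsometry V) : IsIsometry (U * V) := by
  unfold IsIsometry at *
  rw [Matrix.conjTranspose_mul, Matrix.mul_assoc, ← Matrix.mul_assoc Uᴴ, hU, Matrix.one_mul, hV]

/-- The register of `n` qubits is indexed by bit strings. -/
def toBits (n : ℕ) : (Fin n → Fin 2) ≃ BitString n := Equiv.refl _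

/-- The swap isometry of one player, built from observables `X(a)`, `Z(b)`: it extracts the `n`-qubit
register `s`, and leaves an auxiliary `n`-qubit register `t` next to the original space. -/
noncomputable def swapIsometry (X Z : BitString n → Matrix ι ι ℂ) :
    Matrix ((Fin n → Fin 2) × (BitString n × ι)) ι ℂ :=
  fun p j => ((√(2 ^ n) : ℝ) : ℂ)⁻¹ * (fourier Z p.2.1 * X (toBits n p.1 + p.2.1)) p.2.2 j

theorem ofReal_sqrt_inv_mul_self (n : ℕ) :
    ((√(2 ^ n) : ℝ) : ℂ)⁻¹ * ((√(2 ^ n) : ℝ) : ℂ)⁻¹ = ((2 : ℂ) ^ n)⁻¹ := by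
  rw [← mul_inv, ← Complex.ofReal_mul, Real.mul_self_sqrt (by positivity)]
  simp

theorem isIsometry_swapIsometry {X Z : BitString n → Matrix ι ι ℂ}
    (hX : ∀ a, IsReflection (X a)) (hZ : ∀ b, IsReflection (Z b)) :
    IsIsometry (swapIsometry X Z) := by
  refine isIsometry_of_norm fun v => ?_
  have h := sum_referenceComponent (fun a => (hX a).isObs) (fun a => (hZ a).isObs) v
  refine (pow_left_inj₀ (norm_nonneg _) (norm_nonneg _) two_ne_zero).1 ?_
  rw [← h, EuclideanSpace.norm_sq_eq, Fintype.sum_prod_type]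
  simp_rw [Fintype.sum_prod_type]
  rw [Finset.sum_comm]
  refine Finset.sum_congr rfl fun t _ => Fintype.sum_equiv (toBits n) _ _ fun s => ?_
  have h1 : referenceComponent (fun a => op (X a)) (fun a => op (Z a)) v t (toBits n s)
      = ((√(2 ^ n) : ℝ) : ℂ)⁻¹ • op (fourier Z t * X (toBits n s + t)) v := by
    rw [referenceComponent, add_comm t, op_mul]
    congr 1
    exact (op_fourier Z t _).symm
  obtain ⟨v⟩ := v
  rw [h1, EuclideanSpace.norm_sq_eq]
  refine Finset.sum_congr rfl fun i _ => ?_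
  congr 2
  simp only [op_toLp, PiLp.smul_apply, smul_eq_mul, Matrix.mulVec, dotProduct, swapIsometry,
    Finset.mul_sum, mul_assoc]

theorem norm_braEPR_swapIsometry (XA ZA : BitString n → Matrix ι ι ℂ)
    (XB ZB : BitString n → Matrix κ κ ℂ) (ψ : EuclideanSpace ℂ (ι × κ)) :
    ‖op (braEPR n (BitString n × ι) (BitString n × κ))
        (op (swapIsometry XA ZA ⊗ₖ swapIsometry XB ZB) ψ)‖ ^ 2
      = ∑ t, ∑ t', ‖swapComponent (fun a => leftOp κ (XA a)) (fun a => leftOp κ (ZA a))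
          (fun a => rightOp ι (XB a)) (fun a => rightOp ι (ZB a)) ψ t t'‖ ^ 2 := by
  have h1 : ∀ t t', swapComponent (fun a => leftOp κ (XA a)) (fun a => leftOp κ (ZA a))
        (fun a => rightOp ι (XB a)) (fun a => rightOp ι (ZB a)) ψ t t'
      = (((2 : ℂ) ^ n)⁻¹ * ((√(2 ^ n) : ℝ) : ℂ)⁻¹) • ∑ s, op ((fourier ZA t * XA (s + t)) ⊗ₖ
          (fourier ZB t' * XB (s + t'))) ψ := by
    intro t t'
    rw [swapComponent]
    congr 1
    refine Finset.sum_congr rfl fun s _ => ?_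
    rw [← leftOp_fourier, ← rightOp_fourier, ← leftOp_mul, ← rightOp_mul, leftOp_rightOp]
  obtain ⟨ψ⟩ := ψ
  have h2 : ∀ t t' i j, (swapComponent (fun a => leftOp κ (XA a)) (fun a => leftOp κ (ZA a))
        (fun a => rightOp ι (XB a)) (fun a => rightOp ι (ZB a)) (WithLp.toLp 2 ψ) t t') (i, j)
      = (braEPR n (BitString n × ι) (BitString n × κ) *ᵥ
        ((swapIsometry XA ZA ⊗ₖ swapIsometry XB ZB) *ᵥ ψ)) ((t, i), (t', j)) := by
    intro t t' i j
    rw [h1, braEPR_mulVec]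
    simp only [op_toLp, PiLp.smul_apply, WithLp.ofLp_sum, Finset.sum_apply, smul_eq_mul,
      Finset.mul_sum]
    refine (Fintype.sum_equiv (toBits n) _ _ fun s => ?_).symm
    simp only [Matrix.mulVec, dotProduct, Matrix.kroneckerMap_apply, swapIsometry, Finset.mul_sum,
      ← ofReal_sqrt_inv_mul_self]
    refine Finset.sum_congr rfl fun x _ => ?_
    ring
  simp only [op_toLp]
  rw [EuclideanSpace.norm_sq_eq, Fintype.sum_prod_type]
  simp_rw [EuclideanSpace.norm_sq_eq]
  simp_rw [Fintype.sum_prod_type, h2]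
  refine Finset.sum_congr rfl fun t _ => ?_
  rw [Finset.sum_comm]

/-- Reflections of two players that satisfy the approximate Pauli relations on `ψ` yield isometries
which extract `n` EPR pairs. -/
theorem exists_isometry_overlap {XA ZA : BitString n → Matrix ι ι ℂ}
    {XB ZB : BitString n → Matrix κ κ ℂ} (hXA : ∀ a, IsReflection (XA a))
    (hZA : ∀ a, IsReflection (ZA a)) (hXB : ∀ a, IsReflection (XB a))
    (hZB : ∀ a, IsReflection (ZB a)) (h0 : ZB 0 = 1) {ψ : ι × κ → ℂ} (hψ : l2norm ψ = 1) {c : ℝ}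
    (hP : ApproxPauli (fun a => leftOp κ (XA a)) (fun a => leftOp κ (ZA a))
      (fun a => rightOp ι (XB a)) (fun a => rightOp ι (ZB a)) (WithLp.toLp 2 ψ) c) :
    ∃ (d e : ℕ) (ΦA : Matrix ((Fin n → Fin 2) × Fin d) ι ℂ)
      (ΦB : Matrix ((Fin n → Fin 2) × Fin e) κ ℂ), IsIsometry ΦA ∧ IsIsometry ΦB ∧
      ‖eprOverlap ΦA ΦB ψ - 1‖ ≤ min 1 (1449 * c) := by
  refine ⟨_, _, _, _, isIsometry_reindex (Fintype.equivFin (BitString n × ι)).symm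
    (isIsometry_swapIsometry hXA hZA), isIsometry_reindex
    (Fintype.equivFin (BitString n × κ)).symm (isIsometry_swapIsometry hXB hZB), ?_⟩
  have hc : CommutingFamilies (fun a => leftOp κ (XA a)) (fun a => leftOp κ (ZA a))
      (fun a => rightOp ι (XB a)) (fun a => rightOp ι (ZB a)) :=
    { xA := fun a => (hXA a).isObs_leftOp
      zA := fun a => (hZA a).isObs_leftOp
      xB := fun a => (hXB a).isObs_rightOp
      zB := fun a => (hZB a).isObs_rightOp
      xx := fun _ _ _ => leftOp_rightOp_comm _ _ _
      xz := fun _ _ _ => leftOp_rightOp_comm _ _ _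
      zx := fun _ _ _ => leftOp_rightOp_comm _ _ _
      zz := fun _ _ _ => leftOp_rightOp_comm _ _ _
      zB_zero := fun v => by rw [h0, rightOp_one] }
  rw [eprOverlap_reindex, eprOverlap_eq, ← Complex.ofReal_one, ← Complex.ofReal_sub,
    Complex.norm_real, Real.norm_eq_abs, abs_sub_comm]
  have hlow := hc.le_sum_swapComponent hψ hP
  rw [← norm_braEPR_swapIsometry] at hlow
  have hup : ‖op (braEPR n (BitString n × ι) (BitString n × κ))
        (op (swapIsometry XA ZA ⊗ₖ swapIsometry XB ZB) (WithLp.toLp 2 ψ))‖ ≤ 1 := by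
    have h1 := norm_op_conjTranspose_le (isIsometry_braEPR (n := n) (K := BitString n × ι)
      (L := BitString n × κ)) (op (swapIsometry XA ZA ⊗ₖ swapIsometry XB ZB) (WithLp.toLp 2 ψ))
    rw [Matrix.conjTranspose_conjTranspose, norm_op_of_isIsometry (isIsometry_kronecker
      (isIsometry_swapIsometry hXA hZA) (isIsometry_swapIsometry hXB hZB))] at h1
    exact h1.trans_eq hψ
  have hup2 := pow_le_one₀ (n := 2) (norm_nonneg _) hup
  rw [abs_of_nonneg (by linarith)]
  refine le_min ?_ (by linarith)
  linarith [sq_nonneg ‖op (braEPR n (BitString n × ι) (BitString n × κ))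
        (op (swapIsometry XA ZA ⊗ₖ swapIsometry XB ZB) (WithLp.toLp 2 ψ))‖]

end Overlap

/-! ### Projective measurements -/

section Measurements

variable {ι κ α β : Type*} [Fintype ι] [DecidableEq ι] [Fintype κ] [DecidableEq κ] [Fintype α]
  [Fintype β]

/-- A projective measurement, with the orthogonality of its projections as part of the data. -/
structure IsPVM (M : α → Matrix ι ι ℂ) : Prop where
  herm : ∀ x, (M x)ᴴ = M x
  proj : ∀ x, M x * M x = M x
  orth : ∀ x y, x ≠ y → M x * M y = 0
  sum_eq_one : ∑ x, M x = 1

theorem IsPVM.isProjective {M : α → Matrix ι ι ℂ} (h : IsPVM M) : IsProjective M where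
  posSemidef x := by
    have := Matrix.posSemidef_conjTranspose_mul_self (M x)
    rwa [h.herm, h.proj] at this
  sum_eq_one := h.sum_eq_one
  proj := h.proj

theorem IsPVM.comp_equiv {M : α → Matrix ι ι ℂ} (h : IsPVM M) (e : β ≃ α) :
    IsPVM (fun y => M (e y)) where
  herm _ := h.herm _
  proj _ := h.proj _
  orth x y hxy := h.orth _ _ (e.injective.ne hxy)
  sum_eq_one := by rw [← h.sum_eq_one]; exact Fintype.sum_equiv e _ _ fun _ => rfl

theorem IsPVM.signObs_mul {M : α → Matrix ι ι ℂ} (h : IsPVM M) (f g : α → ℤˣ) :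
    signObs f M * signObs g M = signObs (fun x => f x * g x) M := by
  simp only [signObs, Finset.sum_mul_sum]
  refine Finset.sum_congr rfl fun x _ => ?_
  rw [Finset.sum_eq_single x]
  · rw [smul_mul_smul_comm, h.proj]
    push_cast
    rfl
  · intro y _ hy
    rw [smul_mul_smul_comm, h.orth x y hy.symm, smul_zero]
  · simp

theorem IsPVM.isReflection_signObs {M : α → Matrix ι ι ℂ} (h : IsPVM M) (f : α → ℤˣ) :
    IsReflection (signObs f M) where
  herm := by
    simp only [signObs, Matrix.conjTranspose_sum, Matrix.conjTranspose_smul, h.herm]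
    refine Finset.sum_congr rfl fun x _ => ?_
    rcases Int.units_eq_one_or (f x) with h1 | h1 <;> simp [h1]
  sq := by
    rw [h.signObs_mul, ← h.sum_eq_one]
    simp only [signObs, Int.units_mul_self]
    simp

theorem born_eq (ψ : ι × κ → ℂ) (M : Matrix ι ι ℂ) (N : Matrix κ κ ℂ) :
    born ψ M N = (inner ℂ (WithLp.toLp 2 ψ) (op (M ⊗ₖ N) (WithLp.toLp 2 ψ))).re := by
  rw [op_toLp, EuclideanSpace.inner_toLp_toLp, born, dotProduct_comm]

theorem born_one (ψ : ι × κ → ℂ) (hψ : l2norm ψ = 1) :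
    born ψ (1 : Matrix ι ι ℂ) (1 : Matrix κ κ ℂ) = 1 := by
  rw [born_eq, Matrix.one_kronecker_one, op_one, inner_self_eq_norm_sq_to_K]
  change ((((l2norm ψ : ℝ) : ℂ)) ^ 2).re = 1
  simp [hψ]

theorem born_sum (ψ : ι × κ → ℂ) (M : α → Matrix ι ι ℂ) (N : β → Matrix κ κ ℂ) (f : α → ℝ)
    (g : β → ℝ) :
    born ψ (∑ x, (f x : ℂ) • M x) (∑ y, (g y : ℂ) • N y)
      = ∑ x, ∑ y, f x * g y * born ψ (M x) (N y) := by
  have h : (∑ x, (f x : ℂ) • M x) ⊗ₖ (∑ y, (g y : ℂ) • N y)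
      = ∑ x, ∑ y, ((f x * g y : ℝ) : ℂ) • (M x ⊗ₖ N y) := by
    ext i j
    simp only [Matrix.kroneckerMap_apply, Matrix.sum_apply, Matrix.smul_apply, Finset.sum_mul_sum,
      smul_eq_mul, Complex.ofReal_mul]
    exact Finset.sum_congr rfl fun x _ => Finset.sum_congr rfl fun y _ => by ring
  simp only [born, h, Matrix.sum_mulVec, dotProduct_sum, Complex.re_sum, Matrix.smul_mulVec,
    dotProduct_smul, smul_eq_mul, Complex.re_ofReal_mul]

theorem sum_born (ψ : ι × κ → ℂ) (hψ : l2norm ψ = 1) {M : α → Matrix ι ι ℂ}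
    {N : β → Matrix κ κ ℂ} (hM : ∑ x, M x = 1) (hN : ∑ y, N y = 1) :
    ∑ x, ∑ y, born ψ (M x) (N y) = 1 := by
  have := born_sum ψ M N (fun _ => 1) (fun _ => 1)
  simp only [Complex.ofReal_one, one_smul, hM, hN, one_mul, born_one ψ hψ] at this
  exact this.symm

theorem born_nonneg (ψ : ι × κ → ℂ) {M : Matrix ι ι ℂ} {N : Matrix κ κ ℂ} (hM : M.PosSemidef)
    (hN : N.PosSemidef) : 0 ≤ born ψ M N :=
  (hM.kronecker hN).re_dotProduct_nonneg ψ

theorem acceptProb_le_one (ψ : ι × κ → ℂ) (hψ : l2norm ψ = 1) {M : α → Matrix ι ι ℂ}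
    {N : β → Matrix κ κ ℂ} (hM : IsPOVM M) (hN : IsPOVM N) (acc : α → β → Prop) :
    acceptProb ψ M N acc ≤ 1 := by
  rw [← sum_born ψ hψ hM.sum_eq_one hN.sum_eq_one, acceptProb]
  refine Finset.sum_le_sum fun x _ => Finset.sum_le_sum fun y _ => ?_
  split_ifs
  · exact le_rfl
  · exact born_nonneg ψ (hM.posSemidef x) (hN.posSemidef y)

/-- For projective measurements, the mean square distance between two sign observables is four
times the probability that their outcomes differ. -/
theorem norm_sq_signObs_sub (ψ : ι × κ → ℂ) (hψ : l2norm ψ = 1) {M : α → Matrix ι ι ℂ}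
    {N : β → Matrix κ κ ℂ} (hM : IsPVM M) (hN : IsPVM N) (f : α → ℤˣ) (g : β → ℤˣ) :
    ‖leftOp κ (signObs f M) (WithLp.toLp 2 ψ) - rightOp ι (signObs g N) (WithLp.toLp 2 ψ)‖ ^ 2
      = 4 * (1 - acceptProb ψ M N (fun x y => g y = f x)) := by
  have hF := hM.isReflection_signObs f
  have hG := hN.isReflection_signObs g
  have hψ' : ‖WithLp.toLp 2 ψ‖ = 1 := hψ
  rw [@norm_sub_sq ℂ, hF.isObs_leftOp.norm, hG.isObs_rightOp.norm, hψ', RCLike.re_to_complex]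
  have h1 : inner ℂ (leftOp κ (signObs f M) (WithLp.toLp 2 ψ))
      (rightOp ι (signObs g N) (WithLp.toLp 2 ψ))
      = inner ℂ (WithLp.toLp 2 ψ) (op (signObs f M ⊗ₖ signObs g N) (WithLp.toLp 2 ψ)) := by
    rw [leftOp, inner_op_left, Matrix.conjTranspose_kronecker, hF.herm, Matrix.conjTranspose_one]
    exact congrArg _ (leftOp_rightOp _ _ _)
  have h2 : born ψ (signObs f M) (signObs g N)
      = ∑ x, ∑ y, ((f x : ℤ) : ℝ) * ((g y : ℤ) : ℝ) * born ψ (M x) (N y) := by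
    rw [← born_sum]
    simp [signObs]
  have h3 : 2 * acceptProb ψ M N (fun x y => g y = f x) - 1 = born ψ (signObs f M) (signObs g N) := by
    rw [h2, ← sum_born ψ hψ hM.sum_eq_one hN.sum_eq_one, acceptProb, Finset.mul_sum,
      ← Finset.sum_sub_distrib]
    refine Finset.sum_congr rfl fun x _ => ?_
    rw [Finset.mul_sum, ← Finset.sum_sub_distrib]
    refine Finset.sum_congr rfl fun y _ => ?_
    rcases Int.units_eq_one_or (f x) with hx | hx <;> rcases Int.units_eq_one_or (g y) with hy | hy
      <;> simp [hx, hy] <;> ring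
  rw [h1, ← born_eq, ← h3]
  ring

/-! ### Naimark dilation -/

theorem posSemidef_exists_sqrt {M : Matrix ι ι ℂ} (hM : M.PosSemidef) :
    ∃ B : Matrix ι ι ℂ, M = Bᴴ * B := by
  open scoped MatrixOrder in
  exact CStarAlgebra.nonneg_iff_eq_star_mul_self.1 hM.nonneg

/-- The embedding of `ℂ^ι` as the first summand of `ℂ^ι ⊕ ℂ^μ`. -/
def inlEmb (ι μ : Type*) [DecidableEq ι] : Matrix (ι ⊕ μ) ι ℂ := Matrix.fromRows 1 0

theorem isIsometry_inlEmb {μ : Type*} [Fintype μ] : IsIsometry (inlEmb ι μ) := by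
  simp [IsIsometry, inlEmb, Matrix.conjTranspose_fromRows_eq_fromCols_conjTranspose,
    Matrix.fromCols_mul_fromRows]

/-- Naimark's theorem, with a dilation space that only depends on a set `T` which surjects onto the
set of outcomes. For an isometry `V`, the matrix `[[0, Vᴴ], [V, 1 - V Vᴴ]]` is a reflection which
maps `ℂ^ι` to the range of `V`; conjugating a diagonal measurement by it gives the dilation. -/
theorem IsPOVM.exists_dilation {M : α → Matrix ι ι ℂ} (hM : IsPOVM M) {T : Type*} [Fintype T]
    [DecidableEq T] [Nonempty T] {g : T → α} (hg : Function.Surjective g) :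
    ∃ P : α → Matrix (ι ⊕ ι × T) (ι ⊕ ι × T) ℂ, IsPVM P ∧
      ∀ x, (inlEmb ι (ι × T))ᴴ * P x * inlEmb ι (ι × T) = M x := by
  classical
  obtain ⟨f, hf⟩ := hg.hasRightInverse
  choose B hB using fun x => posSemidef_exists_sqrt (hM.posSemidef x)
  let V : Matrix (ι × T) ι ℂ := fun p j => if f (g p.2) = p.2 then B (g p.2) p.1 j else 0
  let D : α → Matrix (ι × T) (ι × T) ℂ := fun x =>
    Matrix.diagonal fun p => if g p.2 = x then 1 else 0
  have hVD : ∀ x, Vᴴ * D x * V = M x := by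
    intro x
    rw [hB x]
    ext i j
    have hDV : ∀ p, (D x * V) p j = if g p.2 = x then V p j else 0 := fun p => by
      simp [D, Matrix.diagonal_mul]
    rw [Matrix.mul_assoc, Matrix.mul_apply, Matrix.mul_apply, Fintype.sum_prod_type]
    have hVs : ∀ p, Vᴴ i p = if f (g p.2) = p.2 then star (B (g p.2) p.1 i) else 0 := fun p => by
      rw [Matrix.conjTranspose_apply]
      simp only [V]
      split_ifs <;> simp
    simp only [hDV, hVs, V]
    refine Finset.sum_congr rfl fun k _ => ?_
    rw [Finset.sum_eq_single (f x)]
    · simp [hf x]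
    · intro t _ ht
      by_cases h1 : g t = x
      · have : f (g t) ≠ t := by rw [h1]; exact ht.symm
        simp [this]
      · simp [h1]
    · simp
  have hD1 : ∑ x, D x = 1 := by
    ext p q
    simp only [D, Matrix.sum_apply, Matrix.diagonal_apply, Matrix.one_apply]
    split_ifs <;> simp
  have hV : Vᴴ * V = 1 := by
    calc Vᴴ * V = Vᴴ * (∑ x, D x) * V := by rw [hD1, Matrix.mul_one]
      _ = ∑ x, Vᴴ * D x * V := by rw [Matrix.mul_sum, Matrix.sum_mul]
      _ = 1 := by simp_rw [hVD]; exact hM.sum_eq_one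
  let W : Matrix (ι ⊕ ι × T) (ι ⊕ ι × T) ℂ := Matrix.fromBlocks 0 Vᴴ V (1 - V * Vᴴ)
  have hWh : Wᴴ = W := by
    simp [W, Matrix.fromBlocks_conjTranspose]
  have hWW : W * W = 1 := by
    have h1 : Vᴴ * (1 - V * Vᴴ) = 0 := by
      rw [Matrix.mul_sub, ← Matrix.mul_assoc, hV]; simp
    have h2 : (1 - V * Vᴴ) * V = 0 := by
      rw [Matrix.sub_mul, Matrix.mul_assoc, hV]; simp
    have h3 : V * Vᴴ + (1 - V * Vᴴ) * (1 - V * Vᴴ) = 1 := by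
      rw [Matrix.mul_sub, Matrix.mul_one, ← Matrix.mul_assoc, h2]; simp
    simp [W, Matrix.fromBlocks_multiply, hV, h1, h2, h3, ← Matrix.fromBlocks_one]
  let x₀ : α := g (Classical.arbitrary T)
  let lab : ι ⊕ ι × T → α := Sum.elim (fun _ => x₀) (fun p => g p.2)
  let Q : α → Matrix (ι ⊕ ι × T) (ι ⊕ ι × T) ℂ := fun x =>
    Matrix.diagonal fun p => if lab p = x then 1 else 0
  have hQQ : ∀ x y, Q x * Q y = if x = y then Q x else 0 := by
    intro x y
    simp only [Q, Matrix.diagonal_mul_diagonal]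
    split_ifs with h
    · subst h; simp
    · ext i j
      rw [Matrix.diagonal_apply]
      by_cases h1 : lab i = x
      · simp [h1, h]
      · simp [h1]
  have hWmul : ∀ x y, (W * Q x * W) * (W * Q y * W) = W * (Q x * Q y) * W := by
    intro x y
    calc (W * Q x * W) * (W * Q y * W) = W * Q x * (W * W) * Q y * W := by noncomm_ring
      _ = _ := by rw [hWW]; noncomm_ring
  refine ⟨fun x => W * Q x * W, ⟨fun x => ?_, fun x => ?_, fun x y hxy => ?_, ?_⟩, fun x => ?_⟩
  · have hQh : (Q x)ᴴ = Q x := by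
      simp only [Q, Matrix.diagonal_conjTranspose]
      congr 1
      funext p
      simp only [Pi.star_apply]
      split_ifs <;> simp
    rw [Matrix.conjTranspose_mul, Matrix.conjTranspose_mul, hWh, hQh, Matrix.mul_assoc]
  · rw [hWmul, hQQ, if_pos rfl]
  · rw [hWmul, hQQ, if_neg hxy]; simp
  · have : ∑ x, Q x = 1 := by
      ext p q
      simp only [Q, Matrix.sum_apply, Matrix.diagonal_apply, Matrix.one_apply]
      split_ifs <;> simp
    rw [← Matrix.sum_mul, ← Matrix.mul_sum, this, Matrix.mul_one, hWW]
  · have h1 : W * inlEmb ι (ι × T) = Matrix.fromRows 0 V := by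
      simp [W, inlEmb, Matrix.fromBlocks_mul_fromRows]
    have h2 : (inlEmb ι (ι × T))ᴴ * W = (W * inlEmb ι (ι × T))ᴴ := by
      rw [Matrix.conjTranspose_mul, hWh]
    have h3 : Q x * Matrix.fromRows (0 : Matrix ι ι ℂ) V
        = Matrix.fromRows (0 : Matrix ι ι ℂ) (D x * V) := by
      ext p j
      rcases p with p | p
      · simp [Q]
      · simp only [Q, D, Matrix.diagonal_mul, Matrix.fromRows_apply_inr]
        rfl
    calc (inlEmb ι (ι × T))ᴴ * (W * Q x * W) * inlEmb ι (ι × T)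
        = ((inlEmb ι (ι × T))ᴴ * W) * (Q x * (W * inlEmb ι (ι × T))) := by
          simp only [Matrix.mul_assoc]
      _ = M x := by
        rw [h2, h1, h3, Matrix.conjTranspose_fromRows_eq_fromCols_conjTranspose,
          Matrix.fromCols_mul_fromRows, ← hVD x]
        simp [Matrix.mul_assoc]

/-- Outcome probabilities of the compressed measurements on `ψ` are those of the dilated ones on
the embedded state. -/
theorem born_compress {ι' κ' : Type*} [Fintype ι'] [Fintype κ'] [DecidableEq ι'] [DecidableEq κ']
    (J : Matrix ι' ι ℂ) (K : Matrix κ' κ ℂ) (M : Matrix ι' ι' ℂ)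
    (N : Matrix κ' κ' ℂ) (ψ : ι × κ → ℂ) :
    born ((J ⊗ₖ K) *ᵥ ψ) M N = born ψ (Jᴴ * M * J) (Kᴴ * N * K) := by
  simp only [born, Matrix.star_mulVec, Matrix.mulVec_mulVec, ← Matrix.dotProduct_mulVec,
    Matrix.conjTranspose_kronecker, Matrix.mul_kronecker_mul, Matrix.mul_assoc]

theorem acceptProb_compress {ι' κ' : Type*} [Fintype ι'] [Fintype κ'] [DecidableEq ι']
    [DecidableEq κ'] (J : Matrix ι' ι ℂ) (K : Matrix κ' κ ℂ) (ψ : ι × κ → ℂ)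
    {M' : α → Matrix ι' ι' ℂ} {N' : β → Matrix κ' κ' ℂ} {M : α → Matrix ι ι ℂ}
    {N : β → Matrix κ κ ℂ} (hM : ∀ x, Jᴴ * M' x * J = M x) (hN : ∀ y, Kᴴ * N' y * K = N y)
    (acc : α → β → Prop) :
    acceptProb ((J ⊗ₖ K) *ᵥ ψ) M' N' acc = acceptProb ψ M N acc := by
  simp only [acceptProb, born_compress, hM, hN]

end Measurements

/-! ### Anticommutation from the game -/

section Rigidity

/-- The anticommutation of the special observables `X`, `Z` of one player in a nearly optimal strategy.
Here `S` and `T'` are the pullbacks of `σ_X` and `σ_Z` on that player's half of the EPR pair, and `S'`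
and `T` those on the other half, so that `X` and `Z` commute with `S'` and `T`. The two halves agree on
the EPR state `ψ'`, where `σ_X` and `σ_Z` anticommute exactly. -/
theorem norm_anticommutator_le {E F : Type*} [NormedAddCommGroup E] [InnerProductSpace ℂ E]
    [NormedAddCommGroup F] [InnerProductSpace ℂ F] {W : E →ₗ[ℂ] F} {W' : F →ₗ[ℂ] E}
    (hW' : ∀ y, ‖W' y‖ ≤ ‖y‖) (hW : ∀ v, ‖W v‖ = ‖v‖)
    {x z x' z' : F →ₗ[ℂ] F} (hx : IsObs x) (hz : IsObs z) (hx' : IsObs x') (hz' : IsObs z')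
    {ψ' : F} (hxx : x' ψ' = x ψ') (hzz : z' ψ' = z ψ') (hxz : x (z ψ') = -z (x ψ'))
    {S S' T T' X Z : E →ₗ[ℂ] E} (hS : ∀ v, S v = W' (x' (W v))) (hS' : ∀ v, S' v = W' (x (W v)))
    (hT : ∀ v, T v = W' (z (W v))) (hT' : ∀ v, T' v = W' (z' (W v)))
    (hTS : ∀ v, T (S v) = W' (z (x' (W v)))) (hST : ∀ v, S' (T' v) = W' (x (z' (W v))))
    (hX : IsObs X) (hZ : IsObs Z) (hXT : ∀ v, X (T v) = T (X v)) (hZS : ∀ v, Z (S' v) = S' (Z v))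
    {ψ : E} {d : ℝ} (h1 : ‖W ψ - ψ'‖ ≤ d) (h2 : ‖X ψ - S ψ‖ ≤ d) (h3 : ‖Z ψ - T ψ‖ ≤ d) :
    ‖X (Z ψ) + Z (X ψ)‖ ≤ 10 * d := by
  have cT : ∀ u v, ‖T u - T v‖ ≤ ‖u - v‖ := fun u v => by
    rw [← map_sub, hT, ← hW (u - v), ← hz.norm (W (u - v))]; exact hW' _
  have cS' : ∀ u v, ‖S' u - S' v‖ ≤ ‖u - v‖ := fun u v => by
    rw [← map_sub, hS', ← hW (u - v), ← hx.norm (W (u - v))]; exact hW' _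
  have cW' : ∀ u v, ‖W' u - W' v‖ ≤ ‖u - v‖ := fun u v => by
    rw [← map_sub]; exact hW' _
  -- on `ψ`, the operator `S` of one player can be replaced by the operator `S'` of the other one
  have dS : ‖S ψ - W' (x ψ')‖ ≤ d := by
    rw [hS, ← hxx]; exact (cW' _ _).trans ((hx'.dist _ _).trans_le h1)
  have dS' : ‖W' (x ψ') - S' ψ‖ ≤ d := by
    rw [hS', norm_sub_rev]; exact (cW' _ _).trans ((hx.dist _ _).trans_le h1)
  have dT : ‖T ψ - W' (z ψ')‖ ≤ d := by
    rw [hT]; exact (cW' _ _).trans ((hz.dist _ _).trans_le h1)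
  have dT' : ‖W' (z ψ') - T' ψ‖ ≤ d := by
    rw [hT', norm_sub_rev, ← hzz]; exact (cW' _ _).trans ((hz'.dist _ _).trans_le h1)
  have a1 : ‖X (Z ψ) - X (T ψ)‖ ≤ d := (hX.dist _ _).trans_le h3
  have a2 : ‖X (T ψ) - T (S ψ)‖ ≤ d := by rw [hXT]; exact (cT _ _).trans h2
  have a3 : ‖T (S ψ) - W' (z (x' ψ'))‖ ≤ d := by
    rw [hTS]
    exact (cW' _ _).trans ((hz.dist _ _).trans_le ((hx'.dist _ _).trans_le h1))
  have b1 : ‖Z (X ψ) - Z (S ψ)‖ ≤ d := (hZ.dist _ _).trans_le h2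
  have b2 : ‖Z (S ψ) - Z (W' (x ψ'))‖ ≤ d := (hZ.dist _ _).trans_le dS
  have b3 : ‖Z (W' (x ψ')) - Z (S' ψ)‖ ≤ d := (hZ.dist _ _).trans_le dS'
  have b4 : ‖Z (S' ψ) - S' (T ψ)‖ ≤ d := by rw [hZS]; exact (cS' _ _).trans h3
  have b5 : ‖S' (T ψ) - S' (W' (z ψ'))‖ ≤ d := (cS' _ _).trans dT
  have b6 : ‖S' (W' (z ψ')) - S' (T' ψ)‖ ≤ d := (cS' _ _).trans dT'
  have b7 : ‖S' (T' ψ) - W' (x (z' ψ'))‖ ≤ d := by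
    rw [hST]
    exact (cW' _ _).trans ((hx.dist _ _).trans_le ((hz'.dist _ _).trans_le h1))
  have e : W' (x (z' ψ')) = -W' (z (x' ψ')) := by rw [hzz, hxx, hxz, map_neg]
  have tr : ∀ {u v t : E} {p q : ℝ}, ‖u - v‖ ≤ p → ‖v - t‖ ≤ q → ‖u - t‖ ≤ p + q :=
    fun h h' => (norm_sub_le_norm_sub_add_norm_sub _ _ _).trans (add_le_add h h')
  have A := tr (tr a1 a2) a3
  have B := tr (tr (tr (tr (tr (tr b1 b2) b3) b4) b5) b6) b7
  have key : X (Z ψ) + Z (X ψ)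
      = (X (Z ψ) - W' (z (x' ψ'))) + (Z (X ψ) - W' (x (z' ψ'))) := by
    rw [e]; abel
  rw [key]
  refine (norm_add_le _ _).trans ?_
  linarith

theorem isReflection_pauliX : IsReflection pauliX where
  herm := by ext i j; fin_cases i <;> fin_cases j <;> simp [pauliX]
  sq := by ext i j; fin_cases i <;> fin_cases j <;> simp [pauliX]

theorem isReflection_pauliZ : IsReflection pauliZ where
  herm := by ext i j; fin_cases i <;> fin_cases j <;> simp [pauliZ]
  sq := by ext i j; fin_cases i <;> fin_cases j <;> simp [pauliZ]

theorem IsReflection.kronecker_one {m k : Type*} [Fintype m] [DecidableEq m] [Fintype k]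
    [DecidableEq k] {M : Matrix m m ℂ} (h : IsReflection M) :
    IsReflection (M ⊗ₖ (1 : Matrix k k ℂ)) where
  herm := by rw [Matrix.conjTranspose_kronecker, h.herm, Matrix.conjTranspose_one]
  sq := by rw [← Matrix.mul_kronecker_mul, h.sq, one_mul, Matrix.one_kronecker_one]

theorem pauliX_kronecker_epr :
    ((1 : Matrix (Fin 2) (Fin 2) ℂ) ⊗ₖ pauliX) *ᵥ epr = (pauliX ⊗ₖ 1) *ᵥ epr := by
  ext ⟨i, j⟩
  fin_cases i <;> fin_cases j <;>
    simp [Matrix.mulVec, dotProduct, Fintype.sum_prod_type, pauliX, epr]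

theorem pauliZ_kronecker_epr :
    ((1 : Matrix (Fin 2) (Fin 2) ℂ) ⊗ₖ pauliZ) *ᵥ epr = (pauliZ ⊗ₖ 1) *ᵥ epr := by
  ext ⟨i, j⟩
  fin_cases i <;> fin_cases j <;>
    simp [Matrix.mulVec, dotProduct, Fintype.sum_prod_type, pauliZ, epr]

theorem pauliX_mul_pauliZ : pauliX * pauliZ = -(pauliZ * pauliX) := by
  ext i j; fin_cases i <;> fin_cases j <;> simp [pauliX, pauliZ]

theorem kronecker_mulVec_tensorState {I J K L : Type*} [Fintype I] [Fintype J] [Fintype K]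
    [Fintype L] [DecidableEq K] [DecidableEq L] (A : Matrix I I ℂ) (B : Matrix J J ℂ)
    (φ : I × J → ℂ) (χ : K × L → ℂ) :
    ((A ⊗ₖ (1 : Matrix K K ℂ)) ⊗ₖ (B ⊗ₖ (1 : Matrix L L ℂ))) *ᵥ tensorState φ χ
      = tensorState ((A ⊗ₖ B) *ᵥ φ) χ := by
  ext ⟨⟨i, k⟩, ⟨j, l⟩⟩
  simp only [Matrix.mulVec, dotProduct, Fintype.sum_prod_type, tensorState,
    Matrix.kroneckerMap_apply, Finset.sum_mul]
  refine Finset.sum_congr rfl fun i' _ => ?_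
  rw [Finset.sum_eq_single k]
  · refine Finset.sum_congr rfl fun j' _ => ?_
    rw [Finset.sum_eq_single l]
    · simp; ring
    · intro l' _ hl'; simp [Matrix.one_apply_ne hl'.symm]
    · simp
  · intro k' _ hk'; simp [Matrix.one_apply_ne hk'.symm]
  · simp

variable {Q₁ Q₂ A₁ A₂ : Type} [Fintype Q₁] [Fintype Q₂] [Fintype A₁] [Fintype A₂]
  {G : TwoPlayerGame Q₁ Q₂ A₁ A₂} {w : ℝ} {δ : ℝ → ℝ} {qX qZ : Q₂} {fX fZ : A₂ → ℤˣ}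

/-- A nearly optimal strategy in an anticommutation game has nearly anticommuting special
observables. -/
theorem IsAnticommutationGame.anticommute (hG : IsAnticommutationGame G w δ qX qZ fX fZ)
    {ι κ : Type} [Fintype ι] [DecidableEq ι] [Fintype κ] [DecidableEq κ] {ψ : ι × κ → ℂ}
    {M : Q₁ → A₁ → Matrix ι ι ℂ} {N : Q₂ → A₂ → Matrix κ κ ℂ} (hψ : l2norm ψ = 1)
    (hM : ∀ q, IsProjective (M q)) (hN : ∀ r, IsProjective (N r))
    (hX : IsReflection (signObs fX (N qX))) (hZ : IsReflection (signObs fZ (N qZ)))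
    {ε : ℝ} (hε : 0 < ε) (hε1 : ε ≤ 1) (hs : w - ε ≤ G.success ψ M N) :
    ‖rightOp ι (signObs fX (N qX)) (rightOp ι (signObs fZ (N qZ)) (WithLp.toLp 2 ψ))
      + rightOp ι (signObs fZ (N qZ)) (rightOp ι (signObs fX (N qX)) (WithLp.toLp 2 ψ))‖
      ≤ 10 * δ ε := by
  obtain ⟨d, e, V, U, χ, hV, hU, -, h1, h2, h3⟩ := hG.sound ι κ ψ M N hψ hM hN ε hε hε1 hs
  have hW := isIsometry_kronecker hV hU
  have compress : ∀ (A : Matrix (Fin 2 × Fin d) (Fin 2 × Fin d) ℂ)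
      (B : Matrix (Fin 2 × Fin e) (Fin 2 × Fin e) ℂ) (v : EuclideanSpace ℂ (ι × κ)),
      op ((V ⊗ₖ U)ᴴ) (op (A ⊗ₖ B) (op (V ⊗ₖ U) v)) = op ((Vᴴ * A * V) ⊗ₖ (Uᴴ * B * U)) v := by
    intro A B v
    rw [← op_mul, ← op_mul, Matrix.conjTranspose_kronecker, ← Matrix.mul_kronecker_mul,
      ← Matrix.mul_kronecker_mul, Matrix.mul_assoc, Matrix.mul_assoc]
  have compressL : ∀ (A : Matrix (Fin 2 × Fin d) (Fin 2 × Fin d) ℂ)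
      (v : EuclideanSpace ℂ (ι × κ)),
      leftOp κ (Vᴴ * A * V) v = op ((V ⊗ₖ U)ᴴ) (leftOp (Fin 2 × Fin e) A (op (V ⊗ₖ U) v)) := by
    intro A v
    rw [leftOp, leftOp, compress, Matrix.mul_one, show Uᴴ * U = 1 from hU]
  have compressR : ∀ (B : Matrix (Fin 2 × Fin e) (Fin 2 × Fin e) ℂ)
      (v : EuclideanSpace ℂ (ι × κ)),
      rightOp ι (Uᴴ * B * U) v = op ((V ⊗ₖ U)ᴴ) (rightOp (Fin 2 × Fin d) B (op (V ⊗ₖ U) v)) := by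
    intro A v
    rw [rightOp, rightOp, compress, Matrix.mul_one, show Vᴴ * V = 1 from hV]
  have rX := isReflection_pauliX
  have rZ := isReflection_pauliZ
  refine norm_anticommutator_le (W := op (V ⊗ₖ U)) (W' := op (V ⊗ₖ U)ᴴ)
    (x := leftOp (Fin 2 × Fin e) (pauliX ⊗ₖ (1 : Matrix (Fin d) (Fin d) ℂ)))
    (z := leftOp (Fin 2 × Fin e) (pauliZ ⊗ₖ (1 : Matrix (Fin d) (Fin d) ℂ)))
    (x' := rightOp (Fin 2 × Fin d) (pauliX ⊗ₖ (1 : Matrix (Fin e) (Fin e) ℂ)))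
    (z' := rightOp (Fin 2 × Fin d) (pauliZ ⊗ₖ (1 : Matrix (Fin e) (Fin e) ℂ)))
    (ψ' := WithLp.toLp 2 (tensorState epr χ))
    (S := rightOp ι (Uᴴ * (pauliX ⊗ₖ (1 : Matrix (Fin e) (Fin e) ℂ)) * U))
    (S' := leftOp κ (Vᴴ * (pauliX ⊗ₖ (1 : Matrix (Fin d) (Fin d) ℂ)) * V))
    (T := leftOp κ (Vᴴ * (pauliZ ⊗ₖ (1 : Matrix (Fin d) (Fin d) ℂ)) * V))
    (T' := rightOp ι (Uᴴ * (pauliZ ⊗ₖ (1 : Matrix (Fin e) (Fin e) ℂ)) * U))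
    (norm_op_conjTranspose_le hW) (norm_op_of_isIsometry hW)
    rX.kronecker_one.isObs_leftOp rZ.kronecker_one.isObs_leftOp
    rX.kronecker_one.isObs_rightOp rZ.kronecker_one.isObs_rightOp ?_ ?_ ?_
    (compressR _) (compressL _) (compressL _) (compressR _) ?_ ?_
    hX.isObs_rightOp hZ.isObs_rightOp (fun v => (leftOp_rightOp_comm _ _ _).symm)
    (fun v => (leftOp_rightOp_comm _ _ _).symm) ?_ ?_ ?_
  · rw [leftOp, rightOp, op_toLp, op_toLp, ← Matrix.one_kronecker_one,
      ← Matrix.one_kronecker_one, kronecker_mulVec_tensorState, kronecker_mulVec_tensorState,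
      pauliX_kronecker_epr]
  · rw [leftOp, rightOp, op_toLp, op_toLp, ← Matrix.one_kronecker_one,
      ← Matrix.one_kronecker_one, kronecker_mulVec_tensorState, kronecker_mulVec_tensorState,
      pauliZ_kronecker_epr]
  · rw [← leftOp_mul, ← leftOp_mul, ← Matrix.mul_kronecker_mul, ← Matrix.mul_kronecker_mul,
      pauliX_mul_pauliZ, leftOp, leftOp, ← op_neg]
    congr 2
    ext i j
    simp [Matrix.kroneckerMap_apply]
  · intro v
    rw [leftOp_rightOp, leftOp_rightOp, compress]
  · intro v
    rw [leftOp_rightOp, leftOp_rightOp, compress]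
  · exact h1
  · rw [Matrix.sub_mulVec] at h2
    exact h2
  · rw [Matrix.sub_mulVec] at h3
    exact h3

theorem l2norm_sq {ι : Type*} [Fintype ι] (v : ι → ℂ) : l2norm v ^ 2 = ∑ i, ‖v i‖ ^ 2 := by
  rw [l2norm, EuclideanSpace.norm_sq_eq]

theorem l2norm_tensorState {I J K L : Type*} [Fintype I] [Fintype J] [Fintype K] [Fintype L]
    {φ : I × J → ℂ} {χ : K × L → ℂ} (hφ : l2norm φ = 1) (hχ : l2norm χ = 1) :
    l2norm (tensorState φ χ) = 1 := by
  have h : l2norm (tensorState φ χ) ^ 2 = l2norm φ ^ 2 * l2norm χ ^ 2 := by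
    simp only [l2norm_sq, Fintype.sum_prod_type, tensorState, norm_mul, mul_pow,
      Finset.sum_mul_sum]
  rw [hφ, hχ, one_pow, one_mul] at h
  exact (pow_eq_one_iff_of_nonneg (norm_nonneg _) two_ne_zero).1 h

theorem l2norm_epr : l2norm epr = 1 := by
  refine (pow_eq_one_iff_of_nonneg (norm_nonneg _) two_ne_zero).1 ?_
  change l2norm epr ^ 2 = 1
  rw [l2norm_sq]
  simp [Fintype.sum_prod_type, epr]
  norm_num

theorem l2norm_eprPow (k : ℕ) : l2norm (eprPow k) = 1 := by
  refine (pow_eq_one_iff_of_nonneg (norm_nonneg _) two_ne_zero).1 ?_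
  change l2norm (eprPow k) ^ 2 = 1
  rw [l2norm_sq]
  simp only [Fintype.sum_prod_type, eprPow_apply]
  have h : ∀ s s' : Fin k → Fin 2, ‖(if s = s' then ((√(2 ^ k) : ℝ) : ℂ)⁻¹ else 0)‖ ^ 2
      = if s = s' then ((2 : ℝ) ^ k)⁻¹ else 0 := by
    intro s s'
    split_ifs
    · rw [norm_inv, Complex.norm_real, inv_pow, Real.norm_of_nonneg (Real.sqrt_nonneg _),
        Real.sq_sqrt (by positivity)]
    · simp
  simp [h]

/-- The constant in the anticommutation bound when `δ(t) ≤ K √t`. -/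
theorem IsAnticommutationGame.anticommute_sqrt (hG : IsAnticommutationGame G w δ qX qZ fX fZ)
    {K : ℝ} (hK : ∀ t ∈ Set.Icc (0 : ℝ) 1, δ t ≤ K * √t)
    {ι κ : Type} [Fintype ι] [DecidableEq ι] [Fintype κ] [DecidableEq κ] {ψ : ι × κ → ℂ}
    {M : Q₁ → A₁ → Matrix ι ι ℂ} {N : Q₂ → A₂ → Matrix κ κ ℂ} (hψ : l2norm ψ = 1)
    (hM : ∀ q, IsProjective (M q)) (hN : ∀ r, IsProjective (N r))
    (hX : IsReflection (signObs fX (N qX))) (hZ : IsReflection (signObs fZ (N qZ)))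
    {ε : ℝ} (hε : 0 < ε) (hs : w - ε ≤ G.success ψ M N) :
    ‖rightOp ι (signObs fX (N qX)) (rightOp ι (signObs fZ (N qZ)) (WithLp.toLp 2 ψ))
      + rightOp ι (signObs fZ (N qZ)) (rightOp ι (signObs fX (N qX)) (WithLp.toLp 2 ψ))‖
      ≤ (10 * |K| + 2) * √ε := by
  have hsq := Real.sqrt_nonneg ε
  by_cases h1 : ε ≤ 1
  · refine (hG.anticommute hψ hM hN hX hZ hε h1 hs).trans ?_
    have := hK ε ⟨hε.le, h1⟩
    nlinarith [le_abs_self K]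
  · have h2 : 1 ≤ √ε := Real.one_le_sqrt.2 (not_le.1 h1).le
    refine (norm_add_le _ _).trans ?_
    rw [hX.isObs_rightOp.norm, hZ.isObs_rightOp.norm, hZ.isObs_rightOp.norm,
      hX.isObs_rightOp.norm, show ‖WithLp.toLp 2 ψ‖ = 1 from hψ]
    nlinarith [abs_nonneg K]

/-- The answer sets of an anticommutation game are nonempty. -/
theorem IsAnticommutationGame.nonempty (hG : IsAnticommutationGame G w δ qX qZ fX fZ) :
    Nonempty A₁ ∧ Nonempty A₂ := by
  obtain ⟨k, M, N, hM, hN, -⟩ := hG.complete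
  have h1 : Nonempty Q₁ := by
    by_contra h
    rw [not_nonempty_iff] at h
    simpa using G.prob_sum
  constructor
  · by_contra h
    rw [not_nonempty_iff] at h
    have := (hM h1.some).sum_eq_one
    simp at this
  · by_contra h
    rw [not_nonempty_iff] at h
    have := (hN qX).sum_eq_one
    simp at this

/-- The special questions are asked with positive probability: otherwise the honest strategy could
answer one of them by a constant, which makes its observable commute with the other one. -/
theorem IsAnticommutationGame.secondProb_pos (hG : IsAnticommutationGame G w δ qX qZ fX fZ)
    {K : ℝ} (hK : ∀ t ∈ Set.Icc (0 : ℝ) 1, δ t ≤ K * √t) {r : Q₂} (hr : r = qX ∨ r = qZ) :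
    0 < G.secondProb r := by
  classical
  by_contra hpos
  have hprob : ∀ q, G.prob q r = 0 := by
    have h0 : G.secondProb r = 0 :=
      le_antisymm (not_lt.1 hpos) (Finset.sum_nonneg fun q _ => G.prob_nonneg q r)
    intro q
    exact (Finset.sum_eq_zero_iff_of_nonneg fun q _ => G.prob_nonneg q r).1 h0 q (Finset.mem_univ q)
  obtain ⟨y₀⟩ := hG.nonempty.2
  obtain ⟨k, M, N, hM, hN, hs, hX, hZ⟩ := hG.complete
  set C : A₂ → Matrix (Fin 2 × (Fin k → Fin 2)) (Fin 2 × (Fin k → Fin 2)) ℂ :=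
    fun y => if y = y₀ then 1 else 0 with hC
  set N' := Function.update N r C with hN'
  have hCobs : ∀ f : A₂ → ℤˣ, signObs f C = ((f y₀ : ℤ) : ℂ) • 1 := by
    intro f; simp [signObs, hC]
  have hCrefl : ∀ f : A₂ → ℤˣ, IsReflection (signObs f C) := by
    intro f
    rw [hCobs]
    rcases Int.units_eq_one_or (f y₀) with h | h <;> constructor <;> simp [h]
  have hN'proj : ∀ q, IsProjective (N' q) := by
    intro q
    by_cases hq : q = r
    · rw [hN', hq, Function.update_self]
      refine ⟨⟨fun y => ?_, by simp [hC]⟩, fun y => ?_⟩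
      · simp only [hC]; split_ifs
        · exact Matrix.PosSemidef.one
        · exact Matrix.PosSemidef.zero
      · simp only [hC]; split_ifs <;> simp
    · rw [hN', Function.update_of_ne hq]
      exact hN q
  have hXr : IsReflection (signObs fX (N' qX)) := by
    by_cases hq : qX = r
    · rw [hN', hq, Function.update_self]; exact hCrefl _
    · rw [hN', Function.update_of_ne hq, hX]; exact isReflection_pauliX.kronecker_one
  have hZr : IsReflection (signObs fZ (N' qZ)) := by
    by_cases hq : qZ = r
    · rw [hN', hq, Function.update_self]; exact hCrefl _
    · rw [hN', Function.update_of_ne hq, hZ]; exact isReflection_pauliZ.kronecker_one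
  have hs' : G.success (tensorState epr (eprPow k)) M N' = w := by
    rw [← hs]
    refine Finset.sum_congr rfl fun q _ => Finset.sum_congr rfl fun q' _ => ?_
    by_cases hq : q' = r
    · rw [hq, hprob, zero_mul, zero_mul]
    · rw [hN', Function.update_of_ne hq]
  have hψ := l2norm_tensorState l2norm_epr (l2norm_eprPow k)
  set c := 10 * |K| + 2 with hc
  have hc0 : 0 < c := by positivity
  have hε : 0 < (1 / c) ^ 2 := by positivity
  have h := hG.anticommute_sqrt hK hψ hM hN'proj hXr hZr hε (by rw [hs']; linarith)
  rw [Real.sqrt_sq (by positivity), ← hc, mul_one_div_cancel hc0.ne'] at h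
  have hcomm : signObs fX (N' qX) * signObs fZ (N' qZ)
      = signObs fZ (N' qZ) * signObs fX (N' qX) := by
    rcases hr with hr | hr
    · have : signObs fX (N' qX) = ((fX y₀ : ℤ) : ℂ) • 1 := by
        rw [hN', ← hr, Function.update_self, hCobs]
      rw [this]; simp
    · have : signObs fZ (N' qZ) = ((fZ y₀ : ℤ) : ℂ) • 1 := by
        rw [hN', ← hr, Function.update_self, hCobs]
      rw [this]; simp
  rw [← rightOp_mul, ← rightOp_mul, ← hcomm, ← two_smul ℂ, norm_smul,
    (hXr.mul_of_commute hZr hcomm).isObs_rightOp.norm,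
    show ‖WithLp.toLp 2 (tensorState epr (eprPow k))‖ = 1 from hψ] at h
  norm_num at h

end Rigidity

/-! ### Dilation of a player's measurements -/

section Players

variable {Q₁ Q₂ A₁ A₂ : Type} [Fintype Q₁] [Fintype Q₂] [Fintype A₁] [Fintype A₂] {n : ℕ}
  {ι κ ι' κ' : Type} [Fintype ι] [DecidableEq ι] [Fintype κ] [DecidableEq κ]
  [Fintype ι'] [DecidableEq ι'] [Fintype κ'] [DecidableEq κ']

/-- All measurements of a player are projective. -/
structure PlayerMeas.IsPVM (P : PlayerMeas n Q₁ Q₂ A₁ A₂ ι) : Prop where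
  wMeas : ∀ W s, PauliBraiding.IsPVM (P.wMeas W s)
  gMeas₁ : ∀ q a b, PauliBraiding.IsPVM (P.gMeas₁ q a b)
  gMeas₂ : ∀ q a b, PauliBraiding.IsPVM (P.gMeas₂ q a b)

/-- The measurements `P` are the compressions along `J` of the measurements `P'`. -/
structure PlayerMeas.Compresses (J : Matrix ι' ι ℂ) (P' : PlayerMeas n Q₁ Q₂ A₁ A₂ ι')
    (P : PlayerMeas n Q₁ Q₂ A₁ A₂ ι) : Prop where
  wMeas : ∀ W s o, Jᴴ * P'.wMeas W s o * J = P.wMeas W s o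
  gMeas₁ : ∀ q a b o, Jᴴ * P'.gMeas₁ q a b o * J = P.gMeas₁ q a b o
  gMeas₂ : ∀ q a b o, Jᴴ * P'.gMeas₂ q a b o * J = P.gMeas₂ q a b o

set_option synthInstance.maxSize 1000 in
theorem PlayerMeas.exists_dilation [Nonempty A₁] [Nonempty A₂]
    (P : PlayerMeas n Q₁ Q₂ A₁ A₂ ι) :
    ∃ (μ : Type) (_ : Fintype μ) (_ : DecidableEq μ) (J : Matrix μ ι ℂ)
      (P' : PlayerMeas n Q₁ Q₂ A₁ A₂ μ), IsIsometry J ∧ P'.IsPVM ∧ P'.Compresses J P := by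
  haveI : DecidableEq A₁ := Classical.decEq _
  haveI : DecidableEq A₂ := Classical.decEq _
  have s0 : Function.Surjective (fun t : (ℤˣ × ℤˣ) × A₁ × A₂ => t.1) := Prod.fst_surjective
  have s1 : Function.Surjective (fun t : (ℤˣ × ℤˣ) × A₁ × A₂ => t.2.1) :=
    Prod.fst_surjective.comp Prod.snd_surjective
  have s2 : Function.Surjective (fun t : (ℤˣ × ℤˣ) × A₁ × A₂ => t.2.2) :=
    Prod.snd_surjective.comp Prod.snd_surjective
  choose w hw hw' using fun W s => (P.wMeas_povm W s).exists_dilation s0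
  choose g₁ hg₁ hg₁' using fun q a b => (P.gMeas₁_povm q a b).exists_dilation s1
  choose g₂ hg₂ hg₂' using fun q a b => (P.gMeas₂_povm q a b).exists_dilation s2
  exact ⟨ι ⊕ ι × (ℤˣ × ℤˣ) × A₁ × A₂, inferInstance, inferInstance, inlEmb ι (ι × (ℤˣ × ℤˣ) × A₁ × A₂),
    { wMeas := w, gMeas₁ := g₁, gMeas₂ := g₂
      wMeas_povm := fun W s => (hw W s).isProjective.toIsPOVM
      gMeas₁_povm := fun q a b => (hg₁ q a b).isProjective.toIsPOVM
      gMeas₂_povm := fun q a b => (hg₂ q a b).isProjective.toIsPOVM },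
    isIsometry_inlEmb, ⟨hw, hg₁, hg₂⟩, ⟨hw', hg₁', hg₂'⟩⟩

theorem PlayerMeas.Compresses.pair {J : Matrix ι' ι ℂ} {P' : PlayerMeas n Q₁ Q₂ A₁ A₂ ι'}
    {P : PlayerMeas n Q₁ Q₂ A₁ A₂ ι} (h : P'.Compresses J P) (W : BasisSetting)
    (a b : BitString n) (o : ℤˣ × ℤˣ) : Jᴴ * P'.pair W a b o * J = P.pair W a b o := by
  unfold PlayerMeas.pair
  split_ifs <;> exact h.wMeas _ _ _

theorem PlayerMeas.Compresses.labelledSuccess {J : Matrix ι' ι ℂ} {K : Matrix κ' κ ℂ}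
    {P' : PlayerMeas n Q₁ Q₂ A₁ A₂ ι'} {P : PlayerMeas n Q₁ Q₂ A₁ A₂ ι}
    {R' : PlayerMeas n Q₁ Q₂ A₁ A₂ κ'} {R : PlayerMeas n Q₁ Q₂ A₁ A₂ κ}
    (hP : P'.Compresses J P) (hR : R'.Compresses K R) (G : TwoPlayerGame Q₁ Q₂ A₁ A₂) (qX qZ : Q₂)
    (fX fZ : A₂ → ℤˣ) (ψ : ι × κ → ℂ) :
    labelledSuccess G qX qZ fX fZ ((J ⊗ₖ K) *ᵥ ψ) P' R' = labelledSuccess G qX qZ fX fZ ψ P R := by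
  have h1 : ∀ W a b W' a' b' acc, acceptProb ((J ⊗ₖ K) *ᵥ ψ) (P'.pair W a b) (R'.pair W' a' b') acc
      = acceptProb ψ (P.pair W a b) (R.pair W' a' b') acc := fun _ _ _ _ _ _ =>
    acceptProb_compress J K ψ (hP.pair _ _ _) (hR.pair _ _ _)
  have h2 : ∀ W a b r a' b' acc,
      acceptProb ((J ⊗ₖ K) *ᵥ ψ) (P'.pair W a b) (R'.gMeas₂ r a' b') acc
      = acceptProb ψ (P.pair W a b) (R.gMeas₂ r a' b') acc := fun _ _ _ _ _ _ =>
    acceptProb_compress J K ψ (hP.pair _ _ _) (hR.gMeas₂ _ _ _)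
  have h3 : ∀ q a b r a' b' acc,
      acceptProb ((J ⊗ₖ K) *ᵥ ψ) (P'.gMeas₁ q a b) (R'.gMeas₂ r a' b') acc
      = acceptProb ψ (P.gMeas₁ q a b) (R.gMeas₂ r a' b') acc := fun _ _ _ _ _ _ =>
    acceptProb_compress J K ψ (hP.gMeas₁ _ _ _) (hR.gMeas₂ _ _ _)
  simp only [PauliBraiding.labelledSuccess, linearityProb, anticommutationProb, consistencyProb,
    TwoPlayerGame.success, h1, h2, h3]

theorem PlayerMeas.pair_povm (P : PlayerMeas n Q₁ Q₂ A₁ A₂ ι) (W : BasisSetting)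
    (a b : BitString n) : IsPOVM (P.pair W a b) := by
  unfold PlayerMeas.pair
  split_ifs
  · exact P.wMeas_povm W (a, b)
  · exact ⟨fun o => (P.wMeas_povm W (b, a)).posSemidef _, by
      rw [← (P.wMeas_povm W (b, a)).sum_eq_one]
      exact Fintype.sum_equiv (Equiv.prodComm _ _) _ _ fun _ => rfl⟩

theorem PlayerMeas.IsPVM.pair {P : PlayerMeas n Q₁ Q₂ A₁ A₂ ι} (h : P.IsPVM) (W : BasisSetting)
    (a b : BitString n) : PauliBraiding.IsPVM (P.pair W a b) := by
  unfold PlayerMeas.pair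
  split_ifs
  · exact h.wMeas W (a, b)
  · exact (h.wMeas W (b, a)).comp_equiv (Equiv.prodComm ℤˣ ℤˣ)

/-! ### Success probabilities of the subtests -/

theorem expect_le_of_nonneg {α : Type*} {s : Finset α} {f : α → ℝ} {c : ℝ} (hc : 0 ≤ c)
    (h : ∀ x ∈ s, f x ≤ c) : 𝔼 x ∈ s, f x ≤ c := by
  rcases s.eq_empty_or_nonempty with rfl | hs
  · simpa using hc
  · exact Finset.expect_le hs h

theorem linearityProb_le_one {ψ : ι × κ → ℂ} (hψ : l2norm ψ = 1)
    (P : PlayerMeas n Q₁ Q₂ A₁ A₂ ι) (R : PlayerMeas n Q₁ Q₂ A₁ A₂ κ) (W : BasisSetting) :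
    linearityProb ψ P R W ≤ 1 := by
  have h := fun a b c d acc => acceptProb_le_one ψ hψ (P.pair_povm W a b) (R.pair_povm W c d) acc
  refine expect_le_of_nonneg zero_le_one fun a _ => expect_le_of_nonneg zero_le_one fun b _ =>
    expect_le_of_nonneg zero_le_one fun d _ => ?_
  linarith [h a b a d (fun x y => y.1 = x.1), h a b b d (fun x y => y.1 = x.2),
    h a b (a + b) d (fun x y => y.1 = x.1 * x.2)]

theorem TwoPlayerGame.secondProb_nonneg (G : TwoPlayerGame Q₁ Q₂ A₁ A₂) (r : Q₂) :
    0 ≤ G.secondProb r := Finset.sum_nonneg fun q _ => G.prob_nonneg q r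

theorem TwoPlayerGame.sum_secondProb (G : TwoPlayerGame Q₁ Q₂ A₁ A₂) :
    ∑ r, G.secondProb r = 1 := by
  rw [← G.prob_sum, Finset.sum_comm]
  rfl

/-- Either part of the consistency test can only lower the acceptance probability. In particular
the failure probability is at least half of the one in a given question of the first part. -/
theorem consistencyProb_le {ψ : ι × κ → ℂ} (hψ : l2norm ψ = 1) (G : TwoPlayerGame Q₁ Q₂ A₁ A₂)
    (qX qZ : Q₂) (fX fZ : A₂ → ℤˣ)
    (P : PlayerMeas n Q₁ Q₂ A₁ A₂ ι) (R : PlayerMeas n Q₁ Q₂ A₁ A₂ κ) (W : BasisSetting) (q : Q₂) :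
    consistencyProb G qX qZ fX fZ ψ P R W ≤ 1 - 𝔼 p ∈ oddPairs n, (1 / 2) * (G.secondProb q *
      (1 - acceptProb ψ (P.pair W p.1 p.2) (R.gMeas₂ q p.1 p.2)
        (consistencyAccept qX qZ fX fZ q W))) := by
  rw [le_sub_iff_add_le, consistencyProb, ← Finset.expect_add_distrib]
  refine expect_le_of_nonneg zero_le_one fun p _ => ?_
  set acc : Q₂ → ℝ := fun r => acceptProb ψ (P.pair W p.1 p.2) (R.gMeas₂ r p.1 p.2)
    (consistencyAccept qX qZ fX fZ r W) with hacc
  have h1 : ∀ r, acc r ≤ 1 := fun r =>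
    acceptProb_le_one ψ hψ (P.pair_povm W _ _) (R.gMeas₂_povm r _ _) _
  have h2 : 𝔼 c : BitString n, acceptProb ψ (P.pair W p.1 p.2) (R.pair W p.1 c)
      (fun x y => x.1 * y.1 = 1) ≤ 1 :=
    expect_le_of_nonneg zero_le_one fun c _ =>
      acceptProb_le_one ψ hψ (P.pair_povm W _ _) (R.pair_povm W _ _) _
  have h3 : G.secondProb q * (1 - acc q) ≤ ∑ r, G.secondProb r * (1 - acc r) :=
    Finset.single_le_sum (f := fun r => G.secondProb r * (1 - acc r))
      (fun r _ => mul_nonneg (G.secondProb_nonneg r) (by linarith [h1 r])) (Finset.mem_univ q)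
  have h4 : ∑ r, G.secondProb r * (1 - acc r) = 1 - ∑ r, G.secondProb r * acc r := by
    simp only [mul_sub, mul_one, Finset.sum_sub_distrib, G.sum_secondProb]
  linarith

theorem consistencyProb_le_one {ψ : ι × κ → ℂ} (hψ : l2norm ψ = 1)
    (G : TwoPlayerGame Q₁ Q₂ A₁ A₂) (qX qZ : Q₂) (fX fZ : A₂ → ℤˣ)
    (P : PlayerMeas n Q₁ Q₂ A₁ A₂ ι) (R : PlayerMeas n Q₁ Q₂ A₁ A₂ κ) (W : BasisSetting) :
    consistencyProb G qX qZ fX fZ ψ P R W ≤ 1 := by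
  refine (consistencyProb_le hψ G qX qZ fX fZ P R W qX).trans (sub_le_self _ ?_)
  refine Finset.expect_nonneg fun p _ => mul_nonneg (by norm_num)
    (mul_nonneg (G.secondProb_nonneg _) (sub_nonneg.2 ?_))
  exact acceptProb_le_one ψ hψ (P.pair_povm W _ _) (R.gMeas₂_povm _ _ _) _

variable {G : TwoPlayerGame Q₁ Q₂ A₁ A₂} {w : ℝ} {δ : ℝ → ℝ} {qX qZ : Q₂} {fX fZ : A₂ → ℤˣ}

theorem IsAnticommutationGame.success_le (hG : IsAnticommutationGame G w δ qX qZ fX fZ)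
    {ψ : ι × κ → ℂ} (hψ : l2norm ψ = 1)
    (P : PlayerMeas n Q₁ Q₂ A₁ A₂ ι) (R : PlayerMeas n Q₁ Q₂ A₁ A₂ κ) (a b : BitString n) :
    G.success ψ (fun q => P.gMeas₁ q a b) (fun r => R.gMeas₂ r a b) ≤ w :=
  hG.optimal ι κ ψ _ _ hψ (fun q => P.gMeas₁_povm q a b) (fun r => R.gMeas₂_povm r a b)

theorem IsAnticommutationGame.anticommutationProb_le
    (hG : IsAnticommutationGame G w δ qX qZ fX fZ) {ψ : ι × κ → ℂ} (hψ : l2norm ψ = 1)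
    (P : PlayerMeas n Q₁ Q₂ A₁ A₂ ι) (R : PlayerMeas n Q₁ Q₂ A₁ A₂ κ) :
    anticommutationProb G ψ P R ≤ w :=
  expect_le_of_nonneg hG.w_pos.le fun p _ => hG.success_le hψ P R p.1 p.2

theorem IsAnticommutationGame.labelledSuccess_le
    (hG : IsAnticommutationGame G w δ qX qZ fX fZ) {ψ : ι × κ → ℂ} (hψ : l2norm ψ = 1)
    (P : PlayerMeas n Q₁ Q₂ A₁ A₂ ι) (R : PlayerMeas n Q₁ Q₂ A₁ A₂ κ) :
    labelledSuccess G qX qZ fX fZ ψ P R ≤ 2 / 3 + 1 / 3 * w := by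
  unfold labelledSuccess
  linarith [linearityProb_le_one hψ P R .X, linearityProb_le_one hψ P R .Z,
    hG.anticommutationProb_le hψ P R, consistencyProb_le_one hψ G qX qZ fX fZ P R .X,
    consistencyProb_le_one hψ G qX qZ fX fZ P R .Z]

/-! ### Consequences of the linearity test -/

/-- The observable for the first string of a pair. -/
noncomputable def PlayerMeas.obs₁ (P : PlayerMeas n Q₁ Q₂ A₁ A₂ ι) (W : BasisSetting)
    (a b : BitString n) : Matrix ι ι ℂ := signObs Prod.fst (P.pair W a b)

/-- The observable for the second string of a pair. -/
noncomputable def PlayerMeas.obs₂ (P : PlayerMeas n Q₁ Q₂ A₁ A₂ ι) (W : BasisSetting)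
    (a b : BitString n) : Matrix ι ι ℂ := signObs Prod.snd (P.pair W a b)

/-- The second string of the second player is independent of the rest of the linearity test, so it
can be fixed to a good value `d`; similarly for the second string of the first player. -/
theorem PlayerMeas.IsPVM.exists_linearity {P : PlayerMeas n Q₁ Q₂ A₁ A₂ ι}
    {R : PlayerMeas n Q₁ Q₂ A₁ A₂ κ} (hP : P.IsPVM) (hR : R.IsPVM) {ψ : ι × κ → ℂ}
    (hψ : l2norm ψ = 1) {W : BasisSetting} {η : ℝ} (h : 1 - η ≤ linearityProb ψ P R W) :
    ∃ c d : BitString n,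
      𝔼 a, ‖leftOp κ (P.obs₁ W a c) (WithLp.toLp 2 ψ)
        - rightOp ι (R.obs₁ W a d) (WithLp.toLp 2 ψ)‖ ^ 2 ≤ 12 * η ∧
      𝔼 a, 𝔼 b, (‖leftOp κ (P.obs₁ W a b) (WithLp.toLp 2 ψ)
          - rightOp ι (R.obs₁ W a d) (WithLp.toLp 2 ψ)‖ ^ 2
        + ‖leftOp κ (P.obs₂ W a b) (WithLp.toLp 2 ψ)
          - rightOp ι (R.obs₁ W b d) (WithLp.toLp 2 ψ)‖ ^ 2
        + ‖leftOp κ (P.obs₁ W a b * P.obs₂ W a b) (WithLp.toLp 2 ψ)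
          - rightOp ι (R.obs₁ W (a + b) d) (WithLp.toLp 2 ψ)‖ ^ 2) ≤ 12 * η := by
  set S : BitString n → BitString n → BitString n → ℝ := fun a b d =>
    ‖leftOp κ (P.obs₁ W a b) (WithLp.toLp 2 ψ) - rightOp ι (R.obs₁ W a d) (WithLp.toLp 2 ψ)‖ ^ 2
    + ‖leftOp κ (P.obs₂ W a b) (WithLp.toLp 2 ψ) - rightOp ι (R.obs₁ W b d) (WithLp.toLp 2 ψ)‖ ^ 2
    + ‖leftOp κ (P.obs₁ W a b * P.obs₂ W a b) (WithLp.toLp 2 ψ)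
          - rightOp ι (R.obs₁ W (a + b) d) (WithLp.toLp 2 ψ)‖ ^ 2 with hS
  have hprob : linearityProb ψ P R W = 𝔼 a, 𝔼 b, 𝔼 d, (1 - S a b d / 12) := by
    refine Finset.expect_congr rfl fun a _ => Finset.expect_congr rfl fun b _ =>
      Finset.expect_congr rfl fun d _ => ?_
    have h1 := norm_sq_signObs_sub ψ hψ (hP.pair W a b) (hR.pair W a d) Prod.fst Prod.fst
    have h2 := norm_sq_signObs_sub ψ hψ (hP.pair W a b) (hR.pair W b d) Prod.snd Prod.fst
    have h3 := norm_sq_signObs_sub ψ hψ (hP.pair W a b) (hR.pair W (a + b) d)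
      (fun x => x.1 * x.2) Prod.fst
    rw [← (hP.pair W a b).signObs_mul] at h3
    simp only [hS, PlayerMeas.obs₁, PlayerMeas.obs₂]
    linarith
  have havg : 𝔼 d, 𝔼 a, 𝔼 b, S a b d ≤ 12 * η := by
    have h1 : 𝔼 d, 𝔼 a, 𝔼 b, S a b d = 𝔼 a, 𝔼 b, 𝔼 d, S a b d := by
      rw [Finset.expect_comm]
      exact Finset.expect_congr rfl fun a _ => Finset.expect_comm _ _ _
    simp only [Finset.expect_sub_distrib, ← Finset.expect_div, Fintype.expect_const] at hprob
    rw [h1]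
    linarith
  obtain ⟨d, -, hd⟩ := Finset.exists_le_of_expect_le Finset.univ_nonempty havg
  have hS1 : 𝔼 c, 𝔼 a, ‖leftOp κ (P.obs₁ W a c) (WithLp.toLp 2 ψ)
      - rightOp ι (R.obs₁ W a d) (WithLp.toLp 2 ψ)‖ ^ 2 ≤ 12 * η := by
    rw [Finset.expect_comm]
    refine (expect_mono fun a => expect_mono fun b => ?_).trans hd
    simp only [hS]
    have := sq_nonneg ‖leftOp κ (P.obs₂ W a b) (WithLp.toLp 2 ψ)
      - rightOp ι (R.obs₁ W b d) (WithLp.toLp 2 ψ)‖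
    have := sq_nonneg ‖leftOp κ (P.obs₁ W a b * P.obs₂ W a b) (WithLp.toLp 2 ψ)
          - rightOp ι (R.obs₁ W (a + b) d) (WithLp.toLp 2 ψ)‖
    linarith
  obtain ⟨c, -, hc⟩ := Finset.exists_le_of_expect_le Finset.univ_nonempty hS1
  exact ⟨c, d, hc, hd⟩

theorem PlayerMeas.IsPVM.isReflection_obs₁ {P : PlayerMeas n Q₁ Q₂ A₁ A₂ ι} (hP : P.IsPVM)
    (W : BasisSetting) (a b : BitString n) : IsReflection (P.obs₁ W a b) :=
  (hP.pair W a b).isReflection_signObs _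

theorem PlayerMeas.IsPVM.isReflection_obs₂ {P : PlayerMeas n Q₁ Q₂ A₁ A₂ ι} (hP : P.IsPVM)
    (W : BasisSetting) (a b : BitString n) : IsReflection (P.obs₂ W a b) :=
  (hP.pair W a b).isReflection_signObs _

theorem PlayerMeas.IsPVM.commute_obs {P : PlayerMeas n Q₁ Q₂ A₁ A₂ ι} (hP : P.IsPVM)
    (W : BasisSetting) (a b : BitString n) :
    P.obs₁ W a b * P.obs₂ W a b = P.obs₂ W a b * P.obs₁ W a b := by
  rw [obs₁, obs₂, (hP.pair W a b).signObs_mul, (hP.pair W a b).signObs_mul]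
  simp only [mul_comm]

/-- Passing the linearity test with high probability makes the second player's observables
approximately linear, after fixing the spectator strings. The observables for the zero string,
which only occurs with probability exponentially small in `n`, are set to `1`. -/
theorem PlayerMeas.IsPVM.exists_linear {P : PlayerMeas n Q₁ Q₂ A₁ A₂ ι}
    {R : PlayerMeas n Q₁ Q₂ A₁ A₂ κ} (hP : P.IsPVM) (hR : R.IsPVM) {ψ : ι × κ → ℂ}
    (hψ : l2norm ψ = 1) {W : BasisSetting} {η : ℝ} (h : 1 - η ≤ linearityProb ψ P R W) :
    ∃ (A : BitString n → Matrix ι ι ℂ) (B : BitString n → Matrix κ κ ℂ),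
      (∀ a, IsReflection (A a)) ∧ (∀ a, IsReflection (B a)) ∧ B 0 = 1 ∧
      𝔼 a, ‖leftOp κ (A a) (WithLp.toLp 2 ψ) - rightOp ι (B a) (WithLp.toLp 2 ψ)‖ ^ 2 ≤ 36 * η ∧
      𝔼 a, 𝔼 b, ‖rightOp ι (B a) (rightOp ι (B b) (WithLp.toLp 2 ψ))
        - rightOp ι (B (a + b)) (WithLp.toLp 2 ψ)‖ ^ 2 ≤ 36 * η ∧
      𝔼 a, 𝔼 b, (if a ⬝ᵥ b = 1 then ‖leftOp κ (P.obs₁ W a b) (WithLp.toLp 2 ψ)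
        - rightOp ι (B a) (WithLp.toLp 2 ψ)‖ ^ 2 else 0) ≤ 12 * η ∧
      𝔼 a, 𝔼 b, (if a ⬝ᵥ b = 1 then ‖leftOp κ (P.obs₂ W a b) (WithLp.toLp 2 ψ)
        - rightOp ι (B b) (WithLp.toLp 2 ψ)‖ ^ 2 else 0) ≤ 12 * η := by
  have hη : 0 ≤ η := by linarith [linearityProb_le_one hψ P R W]
  obtain ⟨c, d, h1, h2⟩ := hP.exists_linearity hR hψ h
  set u : EuclideanSpace ℂ (ι × κ) := WithLp.toLp 2 ψ with hu
  set A : BitString n → Matrix ι ι ℂ := fun a => if a = 0 then 1 else P.obs₁ W a c with hA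
  set B : BitString n → Matrix κ κ ℂ := fun a => if a = 0 then 1 else R.obs₁ W a d with hB
  have rA : ∀ a, IsReflection (A a) := fun a => by
    simp only [hA]; split_ifs
    exacts [isReflection_one, hP.isReflection_obs₁ W a c]
  have rB : ∀ a, IsReflection (B a) := fun a => by
    simp only [hB]; split_ifs
    exacts [isReflection_one, hR.isReflection_obs₁ W a d]
  have hB0 : ∀ a, a ≠ 0 → B a = R.obs₁ W a d := fun a ha => by simp [hB, ha]
  refine ⟨A, B, rA, rB, by simp [hB], ?_, ?_, ?_, ?_⟩
  · refine (expect_mono fun a => ?_).trans (h1.trans (by linarith))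
    by_cases ha : a = 0
    · simp only [hA, hB, ha, if_true, leftOp_one, rightOp_one, sub_self, norm_zero]
      rw [zero_pow two_ne_zero]
      positivity
    · simp only [hA, hB, ha, if_false]
      exact le_rfl
  · have h3 : 𝔼 a, 𝔼 b, 3 * (‖leftOp κ (P.obs₁ W a b) u - rightOp ι (R.obs₁ W a d) u‖ ^ 2
        + ‖leftOp κ (P.obs₂ W a b) u - rightOp ι (R.obs₁ W b d) u‖ ^ 2
        + ‖leftOp κ (P.obs₁ W a b * P.obs₂ W a b) u
          - rightOp ι (R.obs₁ W (a + b) d) u‖ ^ 2) ≤ 36 * η := by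
      simp only [← Finset.mul_expect]
      linarith
    refine (expect_mono fun a => expect_mono fun b => ?_).trans h3
    -- on degenerate pairs, exact linearity holds because of the normalization at `0`
    by_cases hdeg : a = 0 ∨ b = 0 ∨ a + b = 0
    · have : rightOp ι (B a) (rightOp ι (B b) u) - rightOp ι (B (a + b)) u = 0 := by
        rw [sub_eq_zero]
        rcases hdeg with h0 | h0 | h0
        · simp [h0, hB, rightOp_one]
        · simp [h0, hB, rightOp_one]
        · have hab : a = b := by
            calc a = a + (b + b) := by rw [add_self_bits, add_zero]
              _ = b := by rw [← add_assoc, h0, zero_add]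
          rw [h0, hab, (rB b).isObs_rightOp.sq]
          simp [hB, rightOp_one]
      rw [this, norm_zero, zero_pow two_ne_zero]
      positivity
    · push Not at hdeg
      rw [hB0 a hdeg.1, hB0 b hdeg.2.1, hB0 _ hdeg.2.2]
      have t1 : ‖rightOp ι (R.obs₁ W a d) (rightOp ι (R.obs₁ W b d) u)
          - rightOp ι (R.obs₁ W a d) (leftOp κ (P.obs₂ W a b) u)‖
          = ‖leftOp κ (P.obs₂ W a b) u - rightOp ι (R.obs₁ W b d) u‖ := by
        rw [(hR.isReflection_obs₁ W a d).isObs_rightOp.dist, norm_sub_rev]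
      have t2 : ‖rightOp ι (R.obs₁ W a d) (leftOp κ (P.obs₂ W a b) u)
          - leftOp κ (P.obs₁ W a b * P.obs₂ W a b) u‖
          = ‖leftOp κ (P.obs₁ W a b) u - rightOp ι (R.obs₁ W a d) u‖ := by
        rw [hP.commute_obs, leftOp_mul, ← leftOp_rightOp_comm,
          (hP.isReflection_obs₂ W a b).isObs_leftOp.dist, norm_sub_rev]
      have t3 := norm_sub_le_norm_sub_add_norm_sub
        (rightOp ι (R.obs₁ W a d) (rightOp ι (R.obs₁ W b d) u))
        (rightOp ι (R.obs₁ W a d) (leftOp κ (P.obs₂ W a b) u))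
        (rightOp ι (R.obs₁ W (a + b) d) u)
      have t4 := norm_sub_le_norm_sub_add_norm_sub
        (rightOp ι (R.obs₁ W a d) (leftOp κ (P.obs₂ W a b) u))
        (leftOp κ (P.obs₁ W a b * P.obs₂ W a b) u)
        (rightOp ι (R.obs₁ W (a + b) d) u)
      rw [t1] at t3
      rw [t2] at t4
      set p := ‖leftOp κ (P.obs₁ W a b) u - rightOp ι (R.obs₁ W a d) u‖
      set q := ‖leftOp κ (P.obs₂ W a b) u - rightOp ι (R.obs₁ W b d) u‖
      set r := ‖leftOp κ (P.obs₁ W a b * P.obs₂ W a b) u - rightOp ι (R.obs₁ W (a + b) d) u‖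
      refine (pow_le_pow_left₀ (norm_nonneg _) (show _ ≤ p + q + r by linarith) 2).trans ?_
      nlinarith [sq_nonneg (p - q), sq_nonneg (p - r), sq_nonneg (q - r)]
  · refine (expect_mono fun a => expect_mono fun b => ?_).trans h2
    split_ifs with hab
    · have ha : a ≠ 0 := by
        rintro rfl
        simp at hab
      rw [hB0 a ha, add_assoc]
      exact le_add_of_nonneg_right (by positivity)
    · positivity
  · refine (expect_mono fun a => expect_mono fun b => ?_).trans h2
    split_ifs with hab
    · have hb : b ≠ 0 := by
        rintro rfl
        simp at hab
      rw [hB0 b hb, add_right_comm]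
      exact le_add_of_nonneg_left (by positivity)
    · positivity

end Players

/-! ### Anticommutation of the players' observables -/

section Anticommutation

/-- Anticommutation of `Xg` and `Zg` on `u` passes to `X` and `Z`, through operators `a₁`, `a₂` of the
other player that imitate both pairs on `u`. -/
theorem norm_anticommutator_le_of_approx {E : Type*} [NormedAddCommGroup E] [InnerProductSpace ℂ E]
    {X Z Xg Zg a₁ a₂ : E →ₗ[ℂ] E} (hX : IsObs X) (hZ : IsObs Z) (hXg : IsObs Xg) (hZg : IsObs Zg)
    (h1 : IsObs a₁) (h2 : IsObs a₂) (c1 : ∀ v, a₂ (X v) = X (a₂ v)) (c2 : ∀ v, a₁ (Z v) = Z (a₁ v))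
    (c3 : ∀ v, a₂ (Xg v) = Xg (a₂ v)) (c4 : ∀ v, a₁ (Zg v) = Zg (a₁ v)) (u : E) :
    ‖X (Z u) + Z (X u)‖ ≤ 2 * ‖a₁ u - X u‖ + 2 * ‖a₁ u - Xg u‖ + 2 * ‖a₂ u - Z u‖
      + 2 * ‖a₂ u - Zg u‖ + ‖Xg (Zg u) + Zg (Xg u)‖ := by
  have tr : ∀ {x y z : E} {p q : ℝ}, ‖x - y‖ ≤ p → ‖y - z‖ ≤ q → ‖x - z‖ ≤ p + q :=
    fun h h' => (norm_sub_le_norm_sub_add_norm_sub _ _ _).trans (add_le_add h h')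
  have s1 : ‖X (Z u) - X (a₂ u)‖ ≤ ‖a₂ u - Z u‖ := by rw [hX.dist, norm_sub_rev]
  have s2 : ‖X (a₂ u) - a₂ (a₁ u)‖ ≤ ‖a₁ u - X u‖ := by rw [← c1, h2.dist, norm_sub_rev]
  have s3 : ‖a₂ (a₁ u) - Xg (a₂ u)‖ ≤ ‖a₁ u - Xg u‖ := by rw [← c3, h2.dist]
  have s4 : ‖Xg (a₂ u) - Xg (Zg u)‖ ≤ ‖a₂ u - Zg u‖ := by rw [hXg.dist]
  have t1 : ‖Z (X u) - Z (a₁ u)‖ ≤ ‖a₁ u - X u‖ := by rw [hZ.dist, norm_sub_rev]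
  have t2 : ‖Z (a₁ u) - a₁ (a₂ u)‖ ≤ ‖a₂ u - Z u‖ := by rw [← c2, h1.dist, norm_sub_rev]
  have t3 : ‖a₁ (a₂ u) - Zg (a₁ u)‖ ≤ ‖a₂ u - Zg u‖ := by rw [← c4, h1.dist]
  have t4 : ‖Zg (a₁ u) - Zg (Xg u)‖ ≤ ‖a₁ u - Xg u‖ := by rw [hZg.dist]
  have s := tr (tr (tr s1 s2) s3) s4
  have t := tr (tr (tr t1 t2) t3) t4
  have key : X (Z u) + Z (X u) = (X (Z u) - Xg (Zg u)) + (Z (X u) - Zg (Xg u))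
      + (Xg (Zg u) + Zg (Xg u)) := by abel
  rw [key]
  have := norm_add₃_le (a := X (Z u) - Xg (Zg u)) (b := Z (X u) - Zg (Xg u))
    (c := Xg (Zg u) + Zg (Xg u))
  linarith

theorem sq_le_of_le_two_mul_sum {x a b c d e : ℝ} (hx : 0 ≤ x)
    (h : x ≤ 2 * a + 2 * b + 2 * c + 2 * d + e) :
    x ^ 2 ≤ 20 * a ^ 2 + 20 * b ^ 2 + 20 * c ^ 2 + 20 * d ^ 2 + 5 * e ^ 2 := by
  have h1 : x ^ 2 ≤ (2 * a + 2 * b + 2 * c + 2 * d + e) ^ 2 := pow_le_pow_left₀ hx h 2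
  have h2 := sq_sum_le_card_mul_sum_sq (s := (Finset.univ : Finset (Fin 5)))
    (f := ![2 * a, 2 * b, 2 * c, 2 * d, e])
  simp [Fin.sum_univ_succ] at h2
  nlinarith

/-- The average over odd pairs dominates the part of the average over all pairs that comes from
odd pairs. -/
theorem expect_ite_odd_le {n : ℕ} (f : BitString n → BitString n → ℝ) (hf : ∀ a b, 0 ≤ f a b) :
    𝔼 a, 𝔼 b, (if a ⬝ᵥ b = 1 then f a b else 0) ≤ 𝔼 p ∈ oddPairs n, f p.1 p.2 := by
  have h1 : 𝔼 a : BitString n, 𝔼 b, (if a ⬝ᵥ b = 1 then f a b else 0)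
      = (∑ p ∈ oddPairs n, f p.1 p.2) / ((Finset.univ : Finset (BitString n × BitString n)).card : ℝ) := by
    rw [← Finset.expect_product' Finset.univ Finset.univ
      (fun a b : BitString n => if a ⬝ᵥ b = 1 then f a b else 0), Finset.expect_eq_sum_div_card,
      Finset.univ_product_univ, oddPairs, Finset.sum_filter]
  rw [h1, Finset.expect_eq_sum_div_card]
  have h0 : 0 ≤ ∑ p ∈ oddPairs n, f p.1 p.2 := Finset.sum_nonneg fun p _ => hf _ _
  rcases (oddPairs n).eq_empty_or_nonempty with he | hne
  · simp [he]
  · exact div_le_div_of_nonneg_left h0 (by exact_mod_cast hne.card_pos)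
      (by exact_mod_cast Finset.card_le_univ _)

variable {Q₁ Q₂ A₁ A₂ : Type} [Fintype Q₁] [Fintype Q₂] [Fintype A₁] [Fintype A₂] {n : ℕ}
  {ι κ : Type} [Fintype ι] [DecidableEq ι] [Fintype κ] [DecidableEq κ]
  {G : TwoPlayerGame Q₁ Q₂ A₁ A₂} {w : ℝ} {δ : ℝ → ℝ} {qX qZ : Q₂} {fX fZ : A₂ → ℤˣ}

/-- The consistency test relates the first player's observables to those used in the game. -/
theorem PlayerMeas.IsPVM.consistency_game {P : PlayerMeas n Q₁ Q₂ A₁ A₂ ι}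
    {R : PlayerMeas n Q₁ Q₂ A₁ A₂ κ} (hP : P.IsPVM) (hR : R.IsPVM) {ψ : ι × κ → ℂ}
    (hψ : l2norm ψ = 1) {W : BasisSetting} {η : ℝ}
    (h : 1 - η ≤ consistencyProb G qX qZ fX fZ ψ P R W) {q : Q₂} (hq : 0 < G.secondProb q)
    {f : A₂ → ℤˣ} {proj : ℤˣ × ℤˣ → ℤˣ}
    (hacc : consistencyAccept qX qZ fX fZ q W = fun x y => f y = proj x) :
    𝔼 a, 𝔼 b, (if a ⬝ᵥ b = 1 then ‖leftOp κ (signObs proj (P.pair W a b)) (WithLp.toLp 2 ψ)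
      - rightOp ι (signObs f (R.gMeas₂ q a b)) (WithLp.toLp 2 ψ)‖ ^ 2 else 0)
      ≤ 8 * η / G.secondProb q := by
  refine (expect_ite_odd_le _ fun a b => by positivity).trans ?_
  rw [le_div_iff₀ hq]
  have h1 := consistencyProb_le hψ G qX qZ fX fZ P R W q
  have h2 : 𝔼 p ∈ oddPairs n, (1 / 2) * (G.secondProb q *
      (1 - acceptProb ψ (P.pair W p.1 p.2) (R.gMeas₂ q p.1 p.2)
        (consistencyAccept qX qZ fX fZ q W)))
      = (G.secondProb q / 8) * 𝔼 p ∈ oddPairs n,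
        ‖leftOp κ (signObs proj (P.pair W p.1 p.2)) (WithLp.toLp 2 ψ)
        - rightOp ι (signObs f (R.gMeas₂ q p.1 p.2)) (WithLp.toLp 2 ψ)‖ ^ 2 := by
    rw [Finset.mul_expect]
    refine Finset.expect_congr rfl fun p _ => ?_
    rw [norm_sq_signObs_sub ψ hψ (hP.pair W p.1 p.2) (hR.gMeas₂ q p.1 p.2), hacc]
    ring
  rw [h2] at h1
  linarith

/-- The anticommutation test makes the observables used in the game anticommute. -/
theorem IsAnticommutationGame.expect_anticommutator (hG : IsAnticommutationGame G w δ qX qZ fX fZ)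
    {K : ℝ} (hK : ∀ t ∈ Set.Icc (0 : ℝ) 1, δ t ≤ K * √t) {P : PlayerMeas n Q₁ Q₂ A₁ A₂ ι}
    {R : PlayerMeas n Q₁ Q₂ A₁ A₂ κ} (hP : P.IsPVM) (hR : R.IsPVM) {ψ : ι × κ → ℂ}
    (hψ : l2norm ψ = 1) {η : ℝ} (hη : 0 < η) (h : w - η ≤ anticommutationProb G ψ P R) :
    𝔼 a, 𝔼 b, (if a ⬝ᵥ b = 1 then
      ‖rightOp ι (signObs fX (R.gMeas₂ qX a b)) (rightOp ι (signObs fZ (R.gMeas₂ qZ a b))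
        (WithLp.toLp 2 ψ)) + rightOp ι (signObs fZ (R.gMeas₂ qZ a b))
        (rightOp ι (signObs fX (R.gMeas₂ qX a b)) (WithLp.toLp 2 ψ))‖ ^ 2 else 0)
      ≤ (10 * |K| + 2) ^ 2 * (2 * η) := by
  refine (expect_ite_odd_le _ fun a b => by positivity).trans ?_
  set s : BitString n × BitString n → ℝ := fun p =>
    G.success ψ (fun q => P.gMeas₁ q p.1 p.2) (fun r => R.gMeas₂ r p.1 p.2) with hs
  have hsw : ∀ p, s p ≤ w := fun p => hG.success_le hψ P R p.1 p.2
  have h1 : 𝔼 p ∈ oddPairs n, (w - s p + η) ≤ 2 * η := by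
    have h2 : 𝔼 p ∈ oddPairs n, (w - s p + η) = 𝔼 p ∈ oddPairs n, (w + η)
        - anticommutationProb G ψ P R := by
      rw [anticommutationProb, ← Finset.expect_sub_distrib]
      exact Finset.expect_congr rfl fun p _ => by simp only [hs]; ring
    have h3 : 𝔼 p ∈ oddPairs n, (w + η) ≤ w + η :=
      expect_le_of_nonneg (by linarith [hG.w_pos]) fun _ _ => le_rfl
    linarith
  refine le_trans ?_ (mul_le_mul_of_nonneg_left h1 (by positivity))
  rw [Finset.mul_expect]
  refine Finset.expect_le_expect fun p _ => ?_
  -- the defect of the pair is shifted by `η`, since soundness needs a positive error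
  have hpos : 0 < w - s p + η := by linarith [hsw p]
  have h2 := hG.anticommute_sqrt hK hψ (fun q => (hP.gMeas₁ q p.1 p.2).isProjective)
    (fun r => (hR.gMeas₂ r p.1 p.2).isProjective)
    ((hR.gMeas₂ qX p.1 p.2).isReflection_signObs fX)
    ((hR.gMeas₂ qZ p.1 p.2).isReflection_signObs fZ) hpos
    (show w - (w - s p + η) ≤ s p by linarith)
  refine (pow_le_pow_left₀ (norm_nonneg _) h2 2).trans ?_
  rw [mul_pow, Real.sq_sqrt hpos.le]

/-- The constant in the approximate Pauli relations. -/
noncomputable def relationConst (G : TwoPlayerGame Q₁ Q₂ A₁ A₂) (qX qZ : Q₂) (K : ℝ) : ℝ :=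
  6240 + 1920 / G.secondProb qX + 1920 / G.secondProb qZ + 60 * (10 * |K| + 2) ^ 2

/-- For projective strategies the near-optimal success probability yields isometries which extract
EPR pairs. -/
theorem IsAnticommutationGame.exists_isometry_of_isPVM
    (hG : IsAnticommutationGame G w δ qX qZ fX fZ)
    {K : ℝ} (hK : ∀ t ∈ Set.Icc (0 : ℝ) 1, δ t ≤ K * √t) {P : PlayerMeas n Q₁ Q₂ A₁ A₂ ι}
    {R : PlayerMeas n Q₁ Q₂ A₁ A₂ κ} (hP : P.IsPVM) (hR : R.IsPVM) {ψ : ι × κ → ℂ}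
    (hψ : l2norm ψ = 1) {ε : ℝ} (hε : 0 < ε)
    (h : 2 / 3 + 1 / 3 * w - 2 * ε ≤ labelledSuccess G qX qZ fX fZ ψ P R) :
    ∃ (d e : ℕ) (ΦA : Matrix ((Fin n → Fin 2) × Fin d) ι ℂ)
      (ΦB : Matrix ((Fin n → Fin 2) × Fin e) κ ℂ), IsIsometry ΦA ∧ IsIsometry ΦB ∧
      ‖eprOverlap ΦA ΦB ψ - 1‖ ≤ min 1 (1449 * (relationConst G qX qZ K * ε)) := by
  have hpX := hG.secondProb_pos hK (Or.inl rfl : qX = qX ∨ qX = qZ)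
  have hpZ := hG.secondProb_pos hK (Or.inr rfl : qZ = qX ∨ qZ = qZ)
  unfold labelledSuccess at h
  have l1 := linearityProb_le_one hψ P R .X
  have l2 := linearityProb_le_one hψ P R .Z
  have l3 := hG.anticommutationProb_le hψ P R
  have l4 := consistencyProb_le_one hψ G qX qZ fX fZ P R .X
  have l5 := consistencyProb_le_one hψ G qX qZ fX fZ P R .Z
  obtain ⟨XA, XB, hXA, hXB, -, consX, linX, linkX, -⟩ :=
    hP.exists_linear hR hψ (W := .X) (η := 12 * ε) (by linarith)
  obtain ⟨ZA, ZB, hZA, hZB, hZB0, consZ, linZ, -, linkZ⟩ :=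
    hP.exists_linear hR hψ (W := .Z) (η := 12 * ε) (by linarith)
  have gX := hP.consistency_game hR hψ (W := .X) (η := 12 * ε) (G := G) (qX := qX) (qZ := qZ)
    (fX := fX) (fZ := fZ) (by linarith) hpX (f := fX) (proj := Prod.fst)
    (by funext x y; simp [consistencyAccept, eq_comm])
  have gZ := hP.consistency_game hR hψ (W := .Z) (η := 12 * ε) (G := G) (qX := qX) (qZ := qZ)
    (fX := fX) (fZ := fZ) (by linarith) hpZ (f := fZ) (proj := Prod.snd)
    (by funext x y; simp [consistencyAccept, eq_comm])
  have ga := hG.expect_anticommutator hK hP hR hψ (η := 6 * ε) (by linarith) (by linarith)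
  set u : EuclideanSpace ℂ (ι × κ) := WithLp.toLp 2 ψ with hu
  have h1 : 0 ≤ 1920 / G.secondProb qX * ε := by positivity
  have h2 : 0 ≤ 1920 / G.secondProb qZ * ε := by positivity
  have h3 : 0 ≤ 60 * (10 * |K| + 2) ^ 2 * ε := by positivity
  have hc : 432 * ε ≤ relationConst G qX qZ K * ε := by
    unfold relationConst
    linarith
  refine exists_isometry_overlap hXA hZA hXB hZB hZB0 hψ
    ⟨consX.trans (by linarith), consZ.trans (by linarith), linX.trans (by linarith),
      linZ.trans (by linarith), ?_⟩
  have key : ∀ a b : BitString n,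
      (if a ⬝ᵥ b = 1 then ‖rightOp ι (XB a) (rightOp ι (ZB b) u)
        + rightOp ι (ZB b) (rightOp ι (XB a) u)‖ ^ 2 else 0)
      ≤ 20 * (if a ⬝ᵥ b = 1 then ‖leftOp κ (P.obs₁ .X a b) u - rightOp ι (XB a) u‖ ^ 2 else 0)
      + 20 * (if a ⬝ᵥ b = 1 then ‖leftOp κ (signObs Prod.fst (P.pair .X a b)) u
        - rightOp ι (signObs fX (R.gMeas₂ qX a b)) u‖ ^ 2 else 0)
      + 20 * (if a ⬝ᵥ b = 1 then ‖leftOp κ (P.obs₂ .Z a b) u - rightOp ι (ZB b) u‖ ^ 2 else 0)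
      + 20 * (if a ⬝ᵥ b = 1 then ‖leftOp κ (signObs Prod.snd (P.pair .Z a b)) u
        - rightOp ι (signObs fZ (R.gMeas₂ qZ a b)) u‖ ^ 2 else 0)
      + 5 * (if a ⬝ᵥ b = 1 then
      ‖rightOp ι (signObs fX (R.gMeas₂ qX a b)) (rightOp ι (signObs fZ (R.gMeas₂ qZ a b)) u)
        + rightOp ι (signObs fZ (R.gMeas₂ qZ a b))
          (rightOp ι (signObs fX (R.gMeas₂ qX a b)) u)‖ ^ 2 else 0) := by
    intro a b
    split_ifs
    · exact sq_le_of_le_two_mul_sum (norm_nonneg _) (norm_anticommutator_le_of_approx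
        (hXB a).isObs_rightOp (hZB b).isObs_rightOp
        ((hR.gMeas₂ qX a b).isReflection_signObs fX).isObs_rightOp
        ((hR.gMeas₂ qZ a b).isReflection_signObs fZ).isObs_rightOp
        (hP.isReflection_obs₁ .X a b).isObs_leftOp (hP.isReflection_obs₂ .Z a b).isObs_leftOp
        (leftOp_rightOp_comm _ _) (leftOp_rightOp_comm _ _) (leftOp_rightOp_comm _ _)
        (leftOp_rightOp_comm _ _) u)
    · simp
  refine (expect_mono fun a => expect_mono fun b => key a b).trans ?_
  simp only [Finset.expect_add_distrib, ← Finset.mul_expect]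
  have e1 : relationConst G qX qZ K * ε = 6240 * ε + 20 * (8 * (12 * ε) / G.secondProb qX)
      + 20 * (8 * (12 * ε) / G.secondProb qZ) + 5 * ((10 * |K| + 2) ^ 2 * (2 * (6 * ε))) := by
    unfold relationConst
    field_simp
    ring
  rw [e1]
  linarith

theorem min_one_le_rpow {B ε : ℝ} (hB : 0 ≤ B) (hε : 0 < ε) :
    min 1 (B * ε) ≤ (B + 1) * ε ^ (1 / 8 : ℝ) := by
  have h0 : 0 ≤ ε ^ (1 / 8 : ℝ) := Real.rpow_nonneg hε.le _
  rcases le_total ε 1 with h | h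
  · have h1 : ε ≤ ε ^ (1 / 8 : ℝ) := by
      conv_lhs => rw [← Real.rpow_one ε]
      exact Real.rpow_le_rpow_of_exponent_ge hε h (by norm_num)
    refine (min_le_right _ _).trans ?_
    nlinarith
  · have h1 : 1 ≤ ε ^ (1 / 8 : ℝ) := Real.one_le_rpow h (by norm_num)
    refine (min_le_left _ _).trans ?_
    nlinarith

end Anticommutation

end PauliBraiding

theorem corollary3p4 {Q₁ Q₂ A₁ A₂ : Type} [Fintype Q₁] [Fintype Q₂] [Fintype A₁] [Fintype A₂]
    (G : PauliBraiding.TwoPlayerGame Q₁ Q₂ A₁ A₂) (w : ℝ) (δ : ℝ → ℝ)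
    (qX qZ : Q₂) (fX fZ : A₂ → ℤˣ)
    (hG : PauliBraiding.IsAnticommutationGame G w δ qX qZ fX fZ)
    (hδ : ∃ K : ℝ, ∀ t ∈ Set.Icc (0 : ℝ) 1, δ t ≤ K * √t) :
    ∃ C : ℝ, 0 < C ∧
      ∀ (n : ℕ), 1 ≤ n →
      ∀ (ι κ : Type) [Fintype ι] [DecidableEq ι] [Fintype κ] [DecidableEq κ]
        (ψ : ι × κ → ℂ) (P : PauliBraiding.PlayerMeas n Q₁ Q₂ A₁ A₂ ι)
        (R : PauliBraiding.PlayerMeas n Q₁ Q₂ A₁ A₂ κ) (ε : ℝ),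
        PauliBraiding.l2norm ψ = 1 → 0 < ε →
        (2 / 3 + (1 / 3) * w) - ε ≤ PauliBraiding.braidingSuccess G qX qZ fX fZ ψ P R →
        ∃ (d e : ℕ) (ΦA : Matrix ((Fin n → Fin 2) × Fin d) ι ℂ)
          (ΦB : Matrix ((Fin n → Fin 2) × Fin e) κ ℂ),
          PauliBraiding.IsIsometry ΦA ∧ PauliBraiding.IsIsometry ΦB ∧
          ‖PauliBraiding.eprOverlap ΦA ΦB ψ - 1‖ ≤ C * ε ^ (1 / 8 : ℝ) := by
  obtain ⟨K, hK⟩ := hδ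
  have hpX := hG.secondProb_pos hK (Or.inl rfl : qX = qX ∨ qX = qZ)
  have hpZ := hG.secondProb_pos hK (Or.inr rfl : qZ = qX ∨ qZ = qZ)
  have hB : 0 ≤ 1449 * PauliBraiding.relationConst G qX qZ K := by
    unfold PauliBraiding.relationConst
    positivity
  refine ⟨1449 * PauliBraiding.relationConst G qX qZ K + 1, by linarith, ?_⟩
  intro n _ ι κ _ _ _ _ ψ P R ε hψ hε hs
  have hψ' : PauliBraiding.l2norm (fun p : κ × ι => ψ (p.2, p.1)) = 1 := by
    refine (pow_eq_one_iff_of_nonneg (norm_nonneg _) two_ne_zero).1 ?_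
    change PauliBraiding.l2norm _ ^ 2 = 1
    rw [← one_pow 2, ← hψ, PauliBraiding.l2norm_sq, PauliBraiding.l2norm_sq]
    exact Fintype.sum_equiv (Equiv.prodComm κ ι) _ _ fun _ => rfl
  have hlab : 2 / 3 + 1 / 3 * w - 2 * ε
      ≤ PauliBraiding.labelledSuccess G qX qZ fX fZ ψ P R := by
    have := hG.labelledSuccess_le hψ' R P
    unfold PauliBraiding.braidingSuccess at hs
    linarith
  have := hG.nonempty.1
  have := hG.nonempty.2
  obtain ⟨μ, _, _, J, P', hJ, hP', hPc⟩ := P.exists_dilation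
  obtain ⟨ν, _, _, J', R', hJ', hR', hRc⟩ := R.exists_dilation
  have hψJ : PauliBraiding.l2norm (Matrix.kroneckerMap (fun x y => x * y) J J' *ᵥ ψ) = 1 :=
    (PauliBraiding.norm_op_of_isIsometry (PauliBraiding.isIsometry_kronecker hJ hJ')
      (WithLp.toLp 2 ψ)).trans hψ
  rw [← hPc.labelledSuccess hRc] at hlab
  obtain ⟨d, e, ΦA, ΦB, hA, hB', hov⟩ := hG.exists_isometry_of_isPVM hK hP' hR' hψJ hε hlab
  refine ⟨d, e, ΦA * J, ΦB * J', PauliBraiding.isIsometry_mul hA hJ,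
    PauliBraiding.isIsometry_mul hB' hJ', ?_⟩
  rw [PauliBraiding.eprOverlap_mul]
  refine hov.trans ?_
  rw [← mul_assoc]
  exact PauliBraiding.min_one_le_rpow hB hε
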